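/- **Words.** Let $X$ be an alphabet and $X^{\pm}=X\cup X^{-1}$. A countable word is a family $(x_i)_{i\in I}$ of letters of $X^{\pm}$ indexed by a countable linearly ordered set $I$. Write $U\equiv V$ if there is an order isomorphism of the index sets preserving letters; $U^{-1}$ is obtained by reversing the order and inverting all letters. An arch-system on a word is a set of arches in the upper half-plane, each joining two mutually inverse letters, such that different arches are disjoint (in particular have no common endpoint) and every letter between two letters joined by an arch is joined by an arch to another letter between them. A word is reduced if it has no nonempty arch-system, and restricted if every letter of $X^\pm$ occurs in it only finitely often. A tame word is a finite concatenation of restricted reduced words. **The system.** Let $w$ be a tame word with two presentations $$w\equiv w_1\prod_{j=1}^m\theta_j^{-1}\eta_j\theta_j\prod_{i=1}^n[\sigma_i,\tau_i],\qquad w\equiv t_1u_1t_2u_2\cdots t_ku_kt_{k+1},$$ where $[\sigma,\tau]=\sigma^{-1}\tau^{-1}\sigma\tau$, the factors are (possibly empty) words, $m,n,k\ge 0$, and each $u_q$ has a chosen cancellation pattern: a subdivision $u_q\equiv z_1\cdots z_{2r}$ together with a process of $r$ steps, each removing two mutually inverse factors that are neighbours at that moment, at the end of which nothing is left. Visualize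 $w$ as a segment with marked points (its letters). *Lower bands*: glue line-bands to the segments of $w_1$ and of the $\eta_j$, and connect by arch-bands $\theta_j^{-1}$ with $\theta_j$, $\sigma_i^{-1}$ with $\sigma_i$, and $\tau_i^{-1}$ with $\tau_i$. *Upper bands*: glue line-bands to the segments of the $t_q$, and connect by an arch-band each pair of factors removed together in the cancellation patterns of the $u_q$. A line-band contains, for each letter of its segment, a vertical line from this letter to the free side of the band; an arch-band contains, for each pair of corresponding inverse letters of its two segments, an arch connecting them. This is the arch-line-band system of the two presentations. **Leaves and parallelity.** A curve is the union of a finite or infinite sequence of arches and vertical lines, lying alternately in upper and lower bands, such that the terminal point of each is the initial point of the next. A leaf is a maximal curve. Two arches (or lines) are parallel if they lie in the same band. Two nonclosed leaves are parallel if they can be written as finite sequences $\alpha_1\cdots\alpha_p$ and $\beta_1\cdots\beta_p$ of the same length with $\alpha_i,\beta_i$ parallel for all $i$. Two closed leaves are parallel if they can be so written, each as a cyclic sequence without repetitions, with $\alpha_i,\beta_{i+s}$ parallel for some $s$ and all $i$ (indices modulo $p$). **Proposition 6.6.** In the arch-line-band system of any two such presentations of a tame word, parallelity is an equivalence relation on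 the set of leaves, and there are only finitely many parallelity classes of leaves. The same holds if, in the definition of parallel leaves, corresponding arches and lines are required not only to lie in the same band but also to run through it in the same direction. -/

import Mathlib

universe u v

namespace ArchLineBand

/-! ## Countable words -/

/-- The inverse of a letter of `X ∪ X⁻¹`. The pair `(x, true)` is the letter `x`, the pair
`(x, false)` is the letter `x⁻¹`. -/
def invLetter {X : Type u} (a : X × Bool) : X × Bool := (a.1, !a.2)

/-- A countable word over `X`: a family of letters of `X ∪ X⁻¹` indexed by a countable linearly
ordered set of positions. -/
structure Word (X : Type u) where
  Pos : Type v
  [linearOrder : LinearOrder Pos]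
  [countable : Countable Pos]
  letter : Pos → X × Bool

attribute [instance] Word.linearOrder Word.countable

/-- The relation `U ≡ V` between words, as data: an order preserving bijection between the
positions that preserves letters. -/
structure WordIso {X : Type u} (U V : Word.{u, v} X) where
  toOrderIso : U.Pos ≃o V.Pos
  letter_eq : ∀ i, V.letter (toOrderIso i) = U.letter i

namespace Word

variable {X : Type u}

/-- The inverse word: reverse the order and invert all letters. -/
def inv (U : Word.{u, v} X) : Word.{u, v} X where
  Pos := U.Posᵒᵈ
  countable := OrderDual.ofDual.injective.countable
  letter i := invLetter (U.letter (OrderDual.ofDual i))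

/-- The position of the inverse word that corresponds to a position of the word. -/
def invPos (U : Word.{u, v} X) (x : U.Pos) : U.inv.Pos := OrderDual.toDual x

/-- The position of the word that corresponds to a position of the inverse word. -/
def ofInvPos (U : Word.{u, v} X) (x : U.inv.Pos) : U.Pos := OrderDual.ofDual x

/-- The concatenation of a finite family of words, in the order of the index set. A position of it
is a pair `⟨i, x⟩` of an index `i` and a position `x` of the `i`-th factor. -/
def concat {ι : Type} [LinearOrder ι] [Finite ι] (f : ι → Word.{u, v} X) : Word.{u, v} X where
  Pos := Σₗ i, (f i).Pos
  countable := inferInstanceAs (Countable (Σ i, (f i).Pos))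
  letter x := (f (ofLex x).1).letter (ofLex x).2

/-- The position `x` of the `i`-th factor, as a position of the concatenation. -/
def concatPos {ι : Type} [LinearOrder ι] [Finite ι] (f : ι → Word.{u, v} X) (i : ι)
    (x : (f i).Pos) : (concat f).Pos :=
  toLex (⟨i, x⟩ : Σ i, (f i).Pos)

/-- Every letter occurs only finitely many times. -/
def Restricted (W : Word.{u, v} X) : Prop :=
  ∀ a : X × Bool, {i : W.Pos | W.letter i = a}.Finite

/-- An arch-system on a word. The arch with initial point `a` and terminal point `b` is the pair
`(a, b)`. Two half-circles in the upper half-plane are disjoint iff they have no common endpoint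
and their endpoints do not alternate. -/
structure ArchSystem (W : Word.{u, v} X) where
  arches : Set (W.Pos × W.Pos)
  initial_lt_terminal : ∀ a ∈ arches, a.1 < a.2
  inverse_letters : ∀ a ∈ arches, W.letter a.2 = invLetter (W.letter a.1)
  disjoint : ∀ a ∈ arches, ∀ b ∈ arches, a ≠ b →
    (a.1 ≠ b.1 ∧ a.1 ≠ b.2 ∧ a.2 ≠ b.1 ∧ a.2 ≠ b.2) ∧ ¬ (a.1 < b.1 ∧ b.1 < a.2 ∧ a.2 < b.2)
  between : ∀ a ∈ arches, ∀ c, a.1 < c → c < a.2 →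
    ∃ b ∈ arches, (c = b.1 ∨ c = b.2) ∧ a.1 < b.1 ∧ b.2 < a.2

/-- A word is reduced if it carries no arch-system with a nonempty set of arches. -/
def Reduced (W : Word.{u, v} X) : Prop :=
  ∀ A : W.ArchSystem, A.arches = ∅

/-- A tame word is a finite concatenation of restricted reduced words. -/
def Tame (W : Word.{u, v} X) : Prop :=
  ∃ (N : ℕ) (f : Fin N → Word.{u, v} X),
    (∀ i, (f i).Restricted ∧ (f i).Reduced) ∧ Nonempty (WordIso W (concat f))

end Word

/-! ## The two concatenations -/

/-- The names of the factors of `w₁ ∏ⱼ θⱼ⁻¹ ηⱼ θⱼ ∏ᵢ σᵢ⁻¹ τᵢ⁻¹ σᵢ τᵢ`. -/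
inductive LowerIndex (m n : ℕ) : Type
  | w₁ : LowerIndex m n
  | thetaInv (j : Fin m) : LowerIndex m n
  | eta (j : Fin m) : LowerIndex m n
  | theta (j : Fin m) : LowerIndex m n
  | sigmaInv (i : Fin n) : LowerIndex m n
  | tauInv (i : Fin n) : LowerIndex m n
  | sigma (i : Fin n) : LowerIndex m n
  | tau (i : Fin n) : LowerIndex m n

namespace LowerIndex

variable {m n : ℕ}

/-- The place of a factor in the product, counted from `0` to `3 * m + 4 * n`. -/
def place : LowerIndex m n → ℕ
  | w₁ => 0
  | thetaInv j => 3 * j + 1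
  | eta j => 3 * j + 2
  | theta j => 3 * j + 3
  | sigmaInv i => 3 * m + 4 * i + 1
  | tauInv i => 3 * m + 4 * i + 2
  | sigma i => 3 * m + 4 * i + 3
  | tau i => 3 * m + 4 * i + 4

theorem place_injective : Function.Injective (place : LowerIndex m n → ℕ) := by
  intro a b h
  cases a <;> cases b <;> simp only [place] at h <;> first
    | rfl
    | (exfalso; omega)
    | (congr 1; apply Fin.ext; omega)

theorem place_lt (a : LowerIndex m n) : place a < 3 * m + 4 * n + 1 := by
  cases a <;> simp only [place] <;> omega

noncomputable instance : LinearOrder (LowerIndex m n) := LinearOrder.lift' place place_injective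

instance : Finite (LowerIndex m n) :=
  Finite.of_injective (fun a => (⟨place a, place_lt a⟩ : Fin (3 * m + 4 * n + 1)))
    (fun _ _ h => place_injective (congrArg Fin.val h))

end LowerIndex

/-- A presentation `w ≡ w₁ ∏ⱼ θⱼ⁻¹ ηⱼ θⱼ ∏ᵢ [σᵢ, τᵢ]`, with `[a, b] = a⁻¹ b⁻¹ a b`. -/
structure LowerConcatenation {X : Type u} (w : Word.{u, v} X) where
  m : ℕ
  n : ℕ
  w₁ : Word.{u, v} X
  θ : Fin m → Word.{u, v} X
  η : Fin m → Word.{u, v} X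
  σ : Fin n → Word.{u, v} X
  τ : Fin n → Word.{u, v} X
  iso : WordIso w (Word.concat (fun a : LowerIndex m n =>
    match a with
    | .w₁ => w₁
    | .thetaInv j => (θ j).inv
    | .eta j => η j
    | .theta j => θ j
    | .sigmaInv i => (σ i).inv
    | .tauInv i => (τ i).inv
    | .sigma i => σ i
    | .tau i => τ i))

/-- The names of the factors of `t₁ u₁ t₂ u₂ ⋯ tₖ uₖ tₖ₊₁`. -/
inductive UpperIndex (k : ℕ) : Type
  | t (i : Fin (k + 1)) : UpperIndex k
  | u (i : Fin k) : UpperIndex k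

namespace UpperIndex

variable {k : ℕ}

/-- The place of a factor in the product, counted from `0` to `2 * k`. -/
def place : UpperIndex k → ℕ
  | t i => 2 * i
  | u i => 2 * i + 1

theorem place_injective : Function.Injective (place : UpperIndex k → ℕ) := by
  intro a b h
  cases a <;> cases b <;> simp only [place] at h <;> first
    | (exfalso; omega)
    | (congr 1; apply Fin.ext; omega)

theorem place_lt (a : UpperIndex k) : place a < 2 * k + 1 := by
  cases a <;> simp only [place] <;> omega

noncomputable instance : LinearOrder (UpperIndex k) := LinearOrder.lift' place place_injective

instance : Finite (UpperIndex k) :=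
  Finite.of_injective (fun a => (⟨place a, place_lt a⟩ : Fin (2 * k + 1)))
    (fun _ _ h => place_injective (congrArg Fin.val h))

end UpperIndex

/-- A cancellation pattern for a word `u`: a subdivision `u ≡ z₁ z₂ ⋯ z₂ᵣ` together with a process
of `r` steps. The step `s` removes the factors with indices `fst s < snd s`; these are mutually
inverse, and they are neighbours after the removals of the previous steps. After the last step
nothing is left. -/
structure CancellationPattern {X : Type u} (U : Word.{u, v} X) where
  r : ℕ
  z : Fin (2 * r) → Word.{u, v} X
  iso : WordIso U (Word.concat z)
  fst : Fin r → Fin (2 * r)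
  snd : Fin r → Fin (2 * r)
  bijective : Function.Bijective (Sum.elim fst snd)
  fst_lt_snd : ∀ s, fst s < snd s
  neighbours : ∀ s c, fst s < c → c < snd s → ∃ s' < s, c = fst s' ∨ c = snd s'
  inverse : ∀ s, WordIso (z (snd s)) (z (fst s)).inv

/-- A presentation `w ≡ t₁ u₁ t₂ u₂ ⋯ tₖ uₖ tₖ₊₁`, where every `uᵢ` is reducible to the empty word
through a chosen cancellation pattern. -/
structure UpperConcatenation {X : Type u} (w : Word.{u, v} X) where
  k : ℕ
  t : Fin (k + 1) → Word.{u, v} X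
  u : Fin k → Word.{u, v} X
  iso : WordIso w (Word.concat (fun a : UpperIndex k =>
    match a with
    | .t i => t i
    | .u i => u i))
  pattern : ∀ i, CancellationPattern (u i)

/-! ## Line-bands and arch-bands -/

/-- The combinatorial content of the bands glued on one side to a segment whose marked points form
the set `P`: the vertical lines of every line-band, each starting at its foot on the segment
and ending on the free side; and the arches of every arch-band, each connecting two points. -/
structure BandSystem (P : Type v) where
  LineBand : Type
  ArchBand : Type
  Line : LineBand → Type v
  Arch : ArchBand → Type v
  foot : ∀ b, Line b → P
  source : ∀ b, Arch b → P
  target : ∀ b, Arch b → P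

/-- The lower arch-line-band system: line-bands are glued to `w₁` and to the `ηⱼ`, and arch-bands
connect `θⱼ⁻¹` with `θⱼ`, `σᵢ⁻¹` with `σᵢ`, and `τᵢ⁻¹` with `τᵢ`. -/
noncomputable def LowerConcatenation.bands {X : Type u} {w : Word.{u, v} X} (L : LowerConcatenation w) :
    BandSystem w.Pos where
  LineBand := Unit ⊕ Fin L.m
  ArchBand := Fin L.m ⊕ (Fin L.n ⊕ Fin L.n)
  Line
    | .inl _ => L.w₁.Pos
    | .inr j => (L.η j).Pos
  Arch
    | .inl j => (L.θ j).Pos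
    | .inr (.inl i) => (L.σ i).Pos
    | .inr (.inr i) => (L.τ i).Pos
  foot
    | .inl _, x => L.iso.toOrderIso.symm (Word.concatPos _ .w₁ x)
    | .inr j, x => L.iso.toOrderIso.symm (Word.concatPos _ (.eta j) x)
  source
    | .inl j, x => L.iso.toOrderIso.symm (Word.concatPos _ (.thetaInv j) ((L.θ j).invPos x))
    | .inr (.inl i), x =>
        L.iso.toOrderIso.symm (Word.concatPos _ (.sigmaInv i) ((L.σ i).invPos x))
    | .inr (.inr i), x =>
        L.iso.toOrderIso.symm (Word.concatPos _ (.tauInv i) ((L.τ i).invPos x))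
  target
    | .inl j, x => L.iso.toOrderIso.symm (Word.concatPos _ (.theta j) x)
    | .inr (.inl i), x => L.iso.toOrderIso.symm (Word.concatPos _ (.sigma i) x)
    | .inr (.inr i), x => L.iso.toOrderIso.symm (Word.concatPos _ (.tau i) x)

/-- The position of `w` given by the position `x` of the factor `z c` of the subdivision of the
factor `u i`. -/
noncomputable def UpperConcatenation.zPos {X : Type u} {w : Word.{u, v} X} (T : UpperConcatenation w)
    (i : Fin T.k) (c : Fin (2 * (T.pattern i).r)) (x : ((T.pattern i).z c).Pos) : w.Pos :=
  T.iso.toOrderIso.symm (Word.concatPos _ (.u i)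
    ((T.pattern i).iso.toOrderIso.symm (Word.concatPos _ c x)))

/-- The upper arch-line-band system: line-bands are glued to the `tᵢ`, and arch-bands connect
the associated factors of the subdivisions of the `uᵢ`. -/
noncomputable def UpperConcatenation.bands {X : Type u} {w : Word.{u, v} X} (T : UpperConcatenation w) :
    BandSystem w.Pos where
  LineBand := Fin (T.k + 1)
  ArchBand := Σ i : Fin T.k, Fin (T.pattern i).r
  Line i := (T.t i).Pos
  Arch b := ((T.pattern b.1).z ((T.pattern b.1).snd b.2)).Pos
  foot i x := T.iso.toOrderIso.symm (Word.concatPos _ (.t i) x)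
  source b x := T.zPos b.1 ((T.pattern b.1).fst b.2)
    (Word.ofInvPos _ (((T.pattern b.1).inverse b.2).toOrderIso x))
  target b x := T.zPos b.1 ((T.pattern b.1).snd b.2) x

namespace BandSystem

variable {P : Type v}

/-- The vertical lines and arches of the bands. -/
inductive Strand (B : BandSystem P) : Type v
  | line (b : B.LineBand) (x : B.Line b) : Strand B
  | arch (b : B.ArchBand) (x : B.Arch b) : Strand B

/-- The band in which a line or an arch lies. -/
def band (B : BandSystem P) : B.Strand → B.LineBand ⊕ B.ArchBand
  | .line b _ => .inl b
  | .arch b _ => .inr b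

/-- The initial point of a line or arch traversed forward (`true`: from the foot to the free side,
from the source to the target) or backward (`false`); `none` is a point of a free side. -/
def initialPoint (B : BandSystem P) : B.Strand → Bool → Option P
  | .line b x, true => some (B.foot b x)
  | .line _ _, false => none
  | .arch b x, true => some (B.source b x)
  | .arch b x, false => some (B.target b x)

/-- The terminal point of a line or arch traversed forward or backward. -/
def terminalPoint (B : BandSystem P) (s : B.Strand) (d : Bool) : Option P :=
  B.initialPoint s (!d)

end BandSystem

/-! ## The arch-line-band system and its leaves -/

/-- An arch-line-band system: upper and lower bands based on the same segment. -/
structure System (P : Type v) where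
  upper : BandSystem P
  lower : BandSystem P

/-- The arch-line-band system associated with two presentations of the word `w`. -/
noncomputable def system {X : Type u} {w : Word.{u, v} X} (T : UpperConcatenation w) (L : LowerConcatenation w) :
    System w.Pos where
  upper := T.bands
  lower := L.bands

namespace System

variable {P : Type v}

/-- All vertical lines and arches of the system, upper (`inl`) and lower (`inr`) ones. -/
abbrev Strand (A : System P) : Type v := A.upper.Strand ⊕ A.lower.Strand

/-- A vertical line or arch together with a direction. -/
abbrev DirStrand (A : System P) : Type v := A.Strand × Bool

/-- The bands of the system. -/
abbrev Band (A : System P) : Type :=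
  (A.upper.LineBand ⊕ A.upper.ArchBand) ⊕ (A.lower.LineBand ⊕ A.lower.ArchBand)

/-- The band in which a line or an arch lies. -/
def band (A : System P) : A.Strand → A.Band :=
  Sum.map A.upper.band A.lower.band

def initialPoint (A : System P) : A.DirStrand → Option P
  | (.inl s, d) => A.upper.initialPoint s d
  | (.inr s, d) => A.lower.initialPoint s d

def terminalPoint (A : System P) : A.DirStrand → Option P
  | (.inl s, d) => A.upper.terminalPoint s d
  | (.inr s, d) => A.lower.terminalPoint s d

/-- `b` can follow `a` in a curve: one of them is upper and the other lower, and the terminal point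
of `a` is the initial point of `b` (a point of the segment). -/
def Consecutive (A : System P) (a b : A.DirStrand) : Prop :=
  a.1.isLeft ≠ b.1.isLeft ∧ ∃ p : P, A.terminalPoint a = some p ∧ A.initialPoint b = some p

/-- A curve is the union of the members of a finite or infinite sequence (indexed by a nonempty
interval `J` of the integers) of consecutive lines and arches. -/
def IsCurve (A : System P) (C : Set A.Strand) : Prop :=
  ∃ (J : Set ℤ) (γ : J → A.DirStrand), J.Nonempty ∧ J.OrdConnected ∧
    (∀ (j : ℤ) (h : j ∈ J) (h' : j + 1 ∈ J), A.Consecutive (γ ⟨j, h⟩) (γ ⟨j + 1, h'⟩)) ∧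
    C = Set.range (fun j => (γ j).1)

/-- A leaf is a maximal curve. -/
def Leaf (A : System P) : Type v := {C : Set A.Strand // Maximal A.IsCurve C}

/-- The leaf `C` can be written as `σ₁ σ₂ ⋯ σₚ`, where `[σ₁, …, σₚ] = l`. -/
structure Writes (A : System P) (l : List A.DirStrand) (C : A.Leaf) : Prop where
  ne_nil : l ≠ []
  consecutive : l.IsChain A.Consecutive
  nodup : (l.map Prod.fst).Nodup
  union_eq : {s | s ∈ l.map Prod.fst} = C.1

/-- The last member of the sequence is followed by its first member. -/
def ClosesUp (A : System P) (l : List A.DirStrand) : Prop :=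
  ∃ a ∈ l.getLast?, ∃ b ∈ l.head?, A.Consecutive a b

/-- Two lines or two arches are parallel if they lie in the same band. -/
def StrandParallel (A : System P) (a b : A.DirStrand) : Prop :=
  A.band a.1 = A.band b.1

/-- Two lines or arches lie in the same band and run through it in the same direction. -/
def StrandCoherent (A : System P) (a b : A.DirStrand) : Prop :=
  A.band a.1 = A.band b.1 ∧ a.2 = b.2

/-- Two leaves can be written as `σ₁ ⋯ σₚ` and `τ₁ ⋯ τₚ` with `R σᵢ τᵢ` for all `i`, if both are
nonclosed, or with `R σᵢ τᵢ₊ₖ` for some `k` and all `i` modulo `p`, if both are closed. -/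
def LeafRel (A : System P) (R : A.DirStrand → A.DirStrand → Prop) (C D : A.Leaf) : Prop :=
  ∃ l l' : List A.DirStrand, A.Writes l C ∧ A.Writes l' D ∧
    ((¬ A.ClosesUp l ∧ ¬ A.ClosesUp l' ∧ List.Forall₂ R l l') ∨
      (A.ClosesUp l ∧ A.ClosesUp l' ∧ ∃ k : ℕ, List.Forall₂ R l (l'.rotate k)))

/-- Parallel leaves: corresponding lines and arches are parallel. -/
def Parallel (A : System P) (C D : A.Leaf) : Prop :=
  A.LeafRel A.StrandParallel C D

/-- Coherently parallel leaves: corresponding lines and arches lie in the same band, and the two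
leaves run through this band in the same direction. This refines `Parallel`, since
two leaves may also run through an arch-band in opposite directions. -/
def CoherentlyParallel (A : System P) (C D : A.Leaf) : Prop :=
  A.LeafRel A.StrandCoherent C D

end System

end ArchLineBand

/-! Only the few properties collected in `System.Regular` matter. Arches join mutually inverse
letters, so all points of a curve on the segment carry the same letter up to exponent; a tame word
has finitely many such points, hence every leaf is finite. At each point exactly one line or arch (a
strand) starts on either side, so a curve continues in only one way. A leaf is therefore a finite
sequence that closes up or runs from free side to free side, unique up to reversal and, if closed,
rotation (`Writes.eq_rotate_or_rev`). A matching of two leaves can thus be carried over to any other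
writing of one of them, which gives transitivity.

For finiteness, let `S` be a finite set of pairwise not coherently parallel leaves and `Q` the
finite set of their points. Suppose that some `C` in `S` avoids the first and the last point of `Q`
on every segment to which a band is glued. Then each strand of `C` has, on either side, a next
strand of its band with endpoints in `Q`. Moving every strand to the neighbour on the right of the
direction of travel is consistent along the curve, because arch-bands reverse the order, and yields
a leaf `D` coherently parallel to `C` (`Regular.exists_shifted_leaf`). Orient `C` so that an upper
strand starts at its rightmost point `p`. Then `D` contains the next point of `Q` after `p`, hence
belongs to `S`, hence equals `C`, contradicting the choice of `p`.

So every leaf of `S` contains an extreme point. Such a point is determined by a band, a direction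
and the choice of first or last, and lies on only one leaf; this bounds the size of `S` by a
constant (`Regular.ncard_le`). Parallelity is coarser than its coherent version, so it has finitely
many classes too. -/

namespace ArchLineBand

namespace System

/-! ### Directed strands, reversal, saturated sets -/

section Basic

variable {P : Type v}

/-- The same line or arch traversed in the opposite direction. -/
def flip (A : System P) (a : A.DirStrand) : A.DirStrand := (a.1, !a.2)

variable {A : System P}

@[simp] theorem flip_flip (a : A.DirStrand) : A.flip (A.flip a) = a := by
  simp [flip]

@[simp] theorem flip_fst (a : A.DirStrand) : (A.flip a).1 = a.1 := rfl

@[simp] theorem flip_snd (a : A.DirStrand) : (A.flip a).2 = !a.2 := rfl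

theorem flip_ne (a : A.DirStrand) : A.flip a ≠ a := fun h => by
  have := congrArg Prod.snd h
  simp at this

theorem eq_or_eq_flip {a b : A.DirStrand} (h : a.1 = b.1) : a = b ∨ a = A.flip b := by
  obtain ⟨s, d⟩ := a
  obtain ⟨t, e⟩ := b
  obtain rfl : s = t := h
  cases d <;> cases e <;> simp [flip]

@[simp] theorem initialPoint_flip (a : A.DirStrand) :
    A.initialPoint (A.flip a) = A.terminalPoint a := by
  obtain ⟨s | s, d⟩ := a <;> rfl

@[simp] theorem terminalPoint_flip (a : A.DirStrand) :
    A.terminalPoint (A.flip a) = A.initialPoint a := by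
  rw [← initialPoint_flip, flip_flip]

theorem Consecutive.flip {a b : A.DirStrand} (h : A.Consecutive a b) :
    A.Consecutive (A.flip b) (A.flip a) := by
  obtain ⟨h, p, hp, hq⟩ := h
  exact ⟨h.symm, p, by simpa using hq, by simpa using hp⟩

theorem consecutive_flip_iff {a b : A.DirStrand} :
    A.Consecutive (A.flip a) (A.flip b) ↔ A.Consecutive b a :=
  ⟨fun h => by simpa using h.flip, fun h => h.flip⟩

/-- Every line or arch has an endpoint on the segment. -/
theorem exists_terminalPoint {a : A.DirStrand} (h : A.initialPoint a = none) :
    ∃ p, A.terminalPoint a = some p := by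
  obtain ⟨(_ | _) | (_ | _), _ | _⟩ := a <;>
    simp_all [initialPoint, terminalPoint, BandSystem.initialPoint, BandSystem.terminalPoint]

/-- Whether a directed line or arch starts on a free side depends only on its band and
direction. -/
theorem initialPoint_eq_none_of_coherent {a b : A.DirStrand} (h : A.StrandCoherent a b)
    (ha : A.initialPoint a = none) : A.initialPoint b = none := by
  obtain ⟨h, h'⟩ := h
  obtain ⟨(_ | _) | (_ | _), _ | _⟩ := a <;> obtain ⟨(_ | _) | (_ | _), _ | _⟩ := b <;>
    simp_all [initialPoint, BandSystem.initialPoint, band, BandSystem.band]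

theorem isLeft_eq_of_band_eq {a b : A.Strand} (h : A.band a = A.band b) :
    a.isLeft = b.isLeft := by
  cases a <;> cases b <;> simp_all [band]

theorem StrandCoherent.flip {a b : A.DirStrand} (h : A.StrandCoherent a b) :
    A.StrandCoherent (A.flip a) (A.flip b) :=
  ⟨h.1, by simp [h.2]⟩

/-- The properties of the arch-line-band system of two presentations that are needed here: finitely
many bands; at every point of the segment exactly one line or arch starts on each side; the
segments to which the bands are glued are convex; arch-bands reverse the order; and the arches
preserve a key that takes every value only finitely often. -/
structure Regular [LinearOrder P] {X : Type u} (A : System P) (key : P → X) : Prop where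
  finite_band : Finite A.Band
  exists_initial : ∀ (p : P) (c : Bool), ∃ a : A.DirStrand, a.1.isLeft = c ∧
    A.initialPoint a = some p
  unique : ∀ (a b : A.DirStrand) (p : P), a.1.isLeft = b.1.isLeft →
    A.initialPoint a = some p → A.initialPoint b = some p → a = b
  convex : ∀ (a b : A.DirStrand) (p r q : P), A.StrandCoherent a b → A.initialPoint a = some p →
    A.initialPoint b = some q → p ≤ r → r ≤ q →
      ∃ c, A.initialPoint c = some r ∧ A.StrandCoherent a c
  anti : ∀ (a b : A.DirStrand) (p q p' q' : P), A.StrandCoherent a b →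
    A.initialPoint a = some p → A.initialPoint b = some q → A.terminalPoint a = some p' →
    A.terminalPoint b = some q' → p < q → q' < p'
  key_eq : ∀ (a : A.DirStrand) (p q : P), A.initialPoint a = some p →
    A.terminalPoint a = some q → key p = key q
  finite_key : ∀ x, {p | key p = x}.Finite

/-- The sequence of lines and arches of a curve traversed in the opposite direction. -/
def rev (A : System P) (l : List A.DirStrand) : List A.DirStrand := (l.map A.flip).reverse

@[simp] theorem rev_rev (l : List A.DirStrand) : A.rev (A.rev l) = l := by
  simp [rev, Function.comp_def]

@[simp] theorem mem_rev {l : List A.DirStrand} {a : A.DirStrand} :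
    a ∈ A.rev l ↔ A.flip a ∈ l := by
  simp only [rev, List.mem_reverse, List.mem_map]
  constructor
  · rintro ⟨b, hb, rfl⟩
    simpa using hb
  · intro h
    exact ⟨_, h, flip_flip a⟩

@[simp] theorem mem_map_fst_rev {l : List A.DirStrand} {s : A.Strand} :
    s ∈ (A.rev l).map Prod.fst ↔ s ∈ l.map Prod.fst := by
  simp [rev, Function.comp_def]

theorem isChain_rev {l : List A.DirStrand} :
    (A.rev l).IsChain A.Consecutive ↔ l.IsChain A.Consecutive := by
  rw [rev, List.isChain_reverse, List.isChain_map]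
  exact List.IsChain.iff fun a b => consecutive_flip_iff

theorem mem_getLast?_rev {l : List A.DirStrand} {a : A.DirStrand} :
    a ∈ (A.rev l).getLast? ↔ A.flip a ∈ l.head? := by
  cases l with
  | nil => simp [rev]
  | cons b l =>
    simp only [rev, List.getLast?_reverse, List.head?_map, List.head?_cons, Option.map_some,
      Option.mem_def, Option.some.injEq]
    exact ⟨fun h => by rw [← h, flip_flip], fun h => by rw [h, flip_flip]⟩

theorem mem_head?_rev {l : List A.DirStrand} {a : A.DirStrand} :
    a ∈ (A.rev l).head? ↔ A.flip a ∈ l.getLast? := by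
  have := mem_getLast?_rev (l := A.rev l) (a := A.flip a)
  rw [rev_rev, flip_flip] at this
  exact this.symm

theorem ClosesUp.rev {l : List A.DirStrand} (h : A.ClosesUp l) : A.ClosesUp (A.rev l) := by
  obtain ⟨a, ha, b, hb, hab⟩ := h
  exact ⟨A.flip b, by rwa [mem_getLast?_rev, flip_flip], A.flip a,
    by rwa [mem_head?_rev, flip_flip], hab.flip⟩

theorem closesUp_rev {l : List A.DirStrand} : A.ClosesUp (A.rev l) ↔ A.ClosesUp l :=
  ⟨fun h => by simpa using h.rev, fun h => h.rev⟩

/-- A sequence of consecutive lines and arches without repetitions that is closed, or joins a free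
side to a free side. -/
structure Complete (A : System P) (l : List A.DirStrand) : Prop where
  ne_nil : l ≠ []
  chain : l.IsChain A.Consecutive
  nodup : (l.map Prod.fst).Nodup
  ends : A.ClosesUp l ∨ ((∀ a ∈ l.head?, A.initialPoint a = none) ∧
    ∀ a ∈ l.getLast?, A.terminalPoint a = none)

theorem Complete.rev {l : List A.DirStrand} (h : A.Complete l) : A.Complete (A.rev l) where
  ne_nil := by simpa [System.rev] using h.ne_nil
  chain := isChain_rev.2 h.chain
  nodup := by simpa [System.rev, Function.comp_def] using h.nodup
  ends := by
    refine h.ends.imp ClosesUp.rev fun ⟨h1, h2⟩ => ⟨fun a ha => ?_, fun a ha => ?_⟩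
    · simpa using h2 _ (mem_head?_rev.1 ha)
    · simpa using h1 _ (mem_getLast?_rev.1 ha)

/-- A set of lines and arches that contains with each member its neighbours. -/
def Saturated (A : System P) (S : Set A.Strand) : Prop :=
  ∀ a b, A.Consecutive a b → a.1 ∈ S → b.1 ∈ S

theorem Saturated.mem_iff {S : Set A.Strand} (h : A.Saturated S) {a b : A.DirStrand}
    (hab : A.Consecutive a b) : a.1 ∈ S ↔ b.1 ∈ S :=
  ⟨h a b hab, h (A.flip b) (A.flip a) hab.flip⟩

/-- Membership spreads from one strand in both directions along the index interval. This bounds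
curves by a set of strands of one key and makes saturated curves maximal. -/
theorem IsCurve.subset_of_saturated {S C : Set A.Strand} (hC : A.IsCurve C)
    (hS : A.Saturated S) {s : A.Strand} (hs : s ∈ C) (hsS : s ∈ S) : C ⊆ S := by
  obtain ⟨J, γ, -, hJ, hγ, rfl⟩ := hC
  obtain ⟨⟨j, hj⟩, rfl⟩ := hs
  have up : ∀ k, j ≤ k → ∀ hk : k ∈ J, (γ ⟨k, hk⟩).1 ∈ S := by
    intro k hk
    induction k, hk using Int.leInduction with
    | base => exact fun _ => hsS
    | succ k hk ih =>
      intro hk'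
      have hkJ : k ∈ J := hJ.out hj hk' ⟨hk, by omega⟩
      exact hS _ _ (hγ k hkJ hk') (ih hkJ)
  have down : ∀ k, k ≤ j → ∀ hk : k ∈ J, (γ ⟨k, hk⟩).1 ∈ S := by
    intro k hk
    induction k, hk using Int.leInductionDown with
    | base => exact fun _ => hsS
    | pred k hk ih =>
      intro hk'
      have hkJ : k ∈ J := hJ.out hk' hj ⟨by omega, hk⟩
      have hc : A.Consecutive (γ ⟨k - 1, hk'⟩) (γ ⟨k, hkJ⟩) := by
        have := hγ (k - 1) hk' (by simpa using hkJ)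
        simpa using this
      exact (hS.mem_iff hc).2 (ih hkJ)
  rintro _ ⟨⟨k, hk⟩, rfl⟩
  rcases le_total j k with h | h
  · exact up k h hk
  · exact down k h hk

theorem isCurve_of_isChain {l : List A.DirStrand} (hl : l.IsChain A.Consecutive)
    (hne : l ≠ []) : A.IsCurve {s | s ∈ l.map Prod.fst} := by
  have hpos := List.length_pos_iff.2 hne
  refine ⟨Set.Ico 0 (l.length : ℤ), fun j => l[j.1.toNat]'(by
    have := j.2.1; have := j.2.2; omega), ⟨0, by simpa using hpos⟩, Set.ordConnected_Ico, ?_, ?_⟩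
  · intro j hj hj'
    have h1 := hj.1
    have h2 := hj'.2
    have := List.isChain_iff_getElem.1 hl j.toNat (by omega)
    have h3 : (j + 1).toNat = j.toNat + 1 := by omega
    simpa only [h3] using this
  · ext s
    simp only [Set.mem_ofPred_eq, List.mem_map, Set.mem_range, Subtype.exists]
    constructor
    · rintro ⟨a, ha, rfl⟩
      obtain ⟨i, hi, rfl⟩ := List.mem_iff_getElem.1 ha
      exact ⟨i, ⟨by omega, by exact_mod_cast hi⟩, by simp⟩
    · rintro ⟨j, hj, rfl⟩
      exact ⟨_, List.getElem_mem _, rfl⟩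

/-- The lines and arches with an endpoint of the given key. -/
def strandsOfKey {X : Type u} (A : System P) (key : P → X) (x : X) : Set A.Strand :=
  {s | ∃ d p, A.initialPoint (s, d) = some p ∧ key p = x}

theorem exists_mem_strandsOfKey {X : Type u} (key : P → X) (s : A.Strand) :
    ∃ x, s ∈ A.strandsOfKey key x := by
  cases h : A.initialPoint (s, true) with
  | some p => exact ⟨_, _, _, h, rfl⟩
  | none =>
    obtain ⟨p, hp⟩ := exists_terminalPoint h
    exact ⟨key p, false, p, by rw [← hp, ← initialPoint_flip]; rfl, rfl⟩

end Basic

/-! ### Unique continuation and finiteness of curves -/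

section Chains

variable {P : Type v} [LinearOrder P] {X : Type u} {A : System P} {key : P → X}

theorem Regular.right_unique (hA : A.Regular key) {a b c : A.DirStrand}
    (hb : A.Consecutive a b) (hc : A.Consecutive a c) : b = c := by
  obtain ⟨h1, p, hp, hp'⟩ := hb
  obtain ⟨h2, q, hq, hq'⟩ := hc
  obtain rfl : p = q := by simpa [hp] using hq
  refine hA.unique b c p ?_ hp' hq'
  revert h1 h2
  cases a.1.isLeft <;> cases b.1.isLeft <;> cases c.1.isLeft <;> simp

theorem Regular.left_unique (hA : A.Regular key) {a b c : A.DirStrand}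
    (hb : A.Consecutive b a) (hc : A.Consecutive c a) : b = c := by
  simpa using congrArg A.flip (hA.right_unique hb.flip hc.flip)

theorem Regular.exists_consecutive (hA : A.Regular key) {a : A.DirStrand} {p : P}
    (h : A.terminalPoint a = some p) : ∃ b, A.Consecutive a b := by
  obtain ⟨b, hb, hp⟩ := hA.exists_initial p (!a.1.isLeft)
  exact ⟨b, by rw [hb]; cases a.1.isLeft <;> simp, p, h, hp⟩

/-- If a strand reappears reversed, unique continuation makes the strands just inside this stretch
mutually reversed as well. The distance drops by two until it is 0, where `flip` has no fixed point,
or 1, where consecutive strands would lie on the same side. -/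
theorem Regular.getElem_ne_flip (hA : A.Regular key) {l : List A.DirStrand}
    (hl : l.IsChain A.Consecutive) (n : ℕ) : ∀ (i : ℕ) (h : i + n < l.length),
      l[i + n] ≠ A.flip (l[i]'(by omega)) := by
  have hc := List.isChain_iff_getElem.1 hl
  induction n using Nat.strong_induction_on with
  | _ n ih =>
    intro i h heq
    match n, ih, h, heq with
    | 0, _, h, heq => exact flip_ne _ heq.symm
    | 1, _, h, heq =>
      have := (hc i h).1
      rw [heq] at this
      exact this rfl
    | n + 2, ih, h, heq =>
      have h1 := hc i (by omega)
      have h2 := (hc (i + n + 1) h)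
      have h3 : A.Consecutive l[i + n + 1] (A.flip l[i]) := by rw [← heq]; exact h2
      have h4 := h3.flip
      rw [flip_flip] at h4
      have h5 := hA.right_unique h1 h4
      refine ih n (by omega) (i + 1) (by omega) ?_
      have : l[i + 1 + n]'(by omega) = l[i + n + 1] := by congr 1; omega
      rw [this, h5, flip_flip]

/-- A curve does not run through the same line or arch in both directions. -/
theorem Regular.flip_notMem (hA : A.Regular key) {l : List A.DirStrand}
    (hl : l.IsChain A.Consecutive) {a : A.DirStrand} (ha : a ∈ l) : A.flip a ∉ l := by
  intro hb
  obtain ⟨i, hi, rfl⟩ := List.mem_iff_getElem.1 ha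
  obtain ⟨j, hj, hij⟩ := List.mem_iff_getElem.1 hb
  rcases le_total i j with h | h
  · obtain ⟨n, rfl⟩ := Nat.exists_eq_add_of_le h
    exact hA.getElem_ne_flip hl n i hj hij
  · obtain ⟨n, rfl⟩ := Nat.exists_eq_add_of_le h
    exact hA.getElem_ne_flip hl n j hi (by rw [hij, flip_flip])

theorem Regular.fst_injOn (hA : A.Regular key) {l : List A.DirStrand}
    (hl : l.IsChain A.Consecutive) {a b : A.DirStrand} (ha : a ∈ l) (hb : b ∈ l)
    (h : a.1 = b.1) : a = b := by
  rcases eq_or_eq_flip h with h | h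
  · exact h
  · exact absurd (h ▸ ha) (hA.flip_notMem hl hb)

theorem Regular.nodup_map_fst (hA : A.Regular key) {l : List A.DirStrand}
    (hl : l.IsChain A.Consecutive) (hn : l.Nodup) : (l.map Prod.fst).Nodup :=
  hn.map_on fun _ ha _ hb h => hA.fst_injOn hl ha hb h

theorem Complete.mem_of_consecutive (hA : A.Regular key) {l : List A.DirStrand}
    (h : A.Complete l) {a b : A.DirStrand} (ha : a ∈ l) (hab : A.Consecutive a b) : b ∈ l := by
  obtain ⟨l₁, l₂, rfl⟩ := List.append_of_mem ha
  cases l₂ with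
  | cons c l₂ =>
    have := (List.isChain_append_cons_cons.1 h.chain).2.1
    rw [hA.right_unique hab this]
    simp
  | nil =>
    rcases h.ends with ⟨c, hc, d, hd, hcd⟩ | h
    · obtain rfl : a = c := by simpa using hc
      rw [hA.right_unique hab hcd]
      exact List.mem_of_mem_head? hd
    · have := h.2 a (by simp)
      obtain ⟨-, p, hp, -⟩ := hab
      simp [this] at hp

theorem Complete.exists_mem_consecutive (hA : A.Regular key) {l : List A.DirStrand}
    (h : A.Complete l) {a b : A.DirStrand} (hb : b ∈ l) (hab : A.Consecutive a b) : a ∈ l := by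
  have := h.rev.mem_of_consecutive hA (a := A.flip b) (by simpa using hb) hab.flip
  simpa using this

theorem Complete.saturated (hA : A.Regular key) {l : List A.DirStrand} (h : A.Complete l) :
    A.Saturated {s | s ∈ l.map Prod.fst} := by
  intro a b hab ha
  obtain ⟨c, hc, hca⟩ := List.mem_map.1 ha
  rcases eq_or_eq_flip hca with rfl | rfl
  · exact List.mem_map_of_mem (h.mem_of_consecutive hA hc hab)
  · exact List.mem_map.2 ⟨_, h.exists_mem_consecutive hA hc hab.flip, rfl⟩

/-- A curve can only return to its first strand. Returning to a later one would make the last strand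
equal to the predecessor of that one, a repetition; returning in the opposite direction is excluded
by `flip_notMem`. -/
theorem closesUp_of_mem (hA : A.Regular key) {l : List A.DirStrand}
    (hl : l.IsChain A.Consecutive) (hn : l.Nodup) {a b : A.DirStrand} (ha : a ∈ l.getLast?)
    (hab : A.Consecutive a b) (hb : b.1 ∈ l.map Prod.fst) : A.ClosesUp l := by
  obtain ⟨c, hc, hcb⟩ := List.mem_map.1 hb
  rcases eq_or_eq_flip hcb with rfl | rfl
  · obtain ⟨l₁, l₂, rfl⟩ := List.append_of_mem hc
    rcases l₁.eq_nil_or_concat with rfl | ⟨l₁, d, rfl⟩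
    · exact ⟨a, ha, c, by simp, hab⟩
    · exfalso
      rw [List.concat_eq_append, List.append_assoc, List.singleton_append] at hl hn ha
      have := (List.isChain_append_cons_cons.1 hl).2.1
      obtain rfl := hA.left_unique this hab
      have hmem : d ∈ c :: l₂ := by
        apply List.mem_of_mem_getLast?
        rw [List.getLast?_append_cons, List.getLast?_cons_cons] at ha
        exact ha
      have := (List.nodup_append.1 hn).2.1
      exact (List.nodup_cons.1 this).1 hmem
  · exfalso
    have hl' : (l ++ [b]).IsChain A.Consecutive := by
      refine hl.append (List.isChain_singleton _) ?_
      intro x hx y hy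
      obtain rfl : a = x := Option.mem_unique ha hx
      obtain rfl : b = y := by simpa using hy
      exact hab
    exact hA.flip_notMem hl' (a := b) (by simp) (by simp [hc])

theorem terminalPoint_getLast_eq_none (hA : A.Regular key) {l : List A.DirStrand}
    (hl : l.IsChain A.Consecutive) (hn : l.Nodup)
    (hmax : ∀ a ∈ l.getLast?, ∀ b, A.Consecutive a b → b.1 ∈ l.map Prod.fst)
    (hc : ¬ A.ClosesUp l) {a : A.DirStrand} (ha : a ∈ l.getLast?) :
    A.terminalPoint a = none := by
  rw [Option.eq_none_iff_forall_ne_some]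
  intro p hp
  obtain ⟨b, hb⟩ := hA.exists_consecutive hp
  exact hc (closesUp_of_mem hA hl hn ha hb (hmax a ha b hb))

/-- A sequence of consecutive lines and arches without repetitions that cannot be prolonged is
complete. -/
theorem complete_of_maximal (hA : A.Regular key) {l : List A.DirStrand} (hne : l ≠ [])
    (hl : l.IsChain A.Consecutive) (hn : (l.map Prod.fst).Nodup)
    (hlast : ∀ a ∈ l.getLast?, ∀ b, A.Consecutive a b → b.1 ∈ l.map Prod.fst)
    (hhead : ∀ a ∈ l.head?, ∀ b, A.Consecutive b a → b.1 ∈ l.map Prod.fst) : A.Complete l := by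
  refine ⟨hne, hl, hn, or_iff_not_imp_left.2 fun hc => ⟨fun a ha => ?_, fun a ha => ?_⟩⟩
  · have := terminalPoint_getLast_eq_none hA (isChain_rev.2 hl)
      (List.nodup_reverse.2 ((List.Nodup.of_map _ hn).map
        (Function.LeftInverse.injective (g := A.flip) flip_flip)))
      (fun a ha b hb => mem_map_fst_rev.2 (hhead _ (mem_getLast?_rev.1 ha) (A.flip b) hb.flip))
      (fun h => hc (closesUp_rev.1 h)) (a := A.flip a)
      (mem_getLast?_rev.2 (by rwa [flip_flip]))
    simpa using this
  · exact terminalPoint_getLast_eq_none hA hl (List.Nodup.of_map _ hn) hlast hc ha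

theorem Regular.finite_strandsOfKey (hA : A.Regular key) (x : X) :
    (A.strandsOfKey key x).Finite := by
  have : A.strandsOfKey key x ⊆ ⋃ p ∈ {p | key p = x}, ⋃ c : Bool,
      {s | s.isLeft = c ∧ ∃ d, A.initialPoint (s, d) = some p} := by
    rintro s ⟨d, p, hp, hx⟩
    simp only [Set.mem_iUnion]
    exact ⟨p, hx, s.isLeft, rfl, d, hp⟩
  refine Set.Finite.subset ((hA.finite_key x).biUnion fun p _ => Set.finite_iUnion fun c => ?_) this
  refine Set.Subsingleton.finite ?_
  rintro s ⟨hs, d, hd⟩ t ⟨ht, e, he⟩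
  exact congrArg Prod.fst (hA.unique (s, d) (t, e) p (hs.trans ht.symm) hd he)

/-- The key agrees at both ends of an arch, and consecutive strands share a point, so the key is
constant along curves. -/
theorem Regular.saturated_strandsOfKey (hA : A.Regular key) (x : X) :
    A.Saturated (A.strandsOfKey key x) := by
  rintro a b ⟨-, q, haq, hbq⟩ ⟨d, p, hp, hx⟩
  refine ⟨b.2, q, hbq, ?_⟩
  rcases eq_or_eq_flip (a := (a.1, d)) (b := a) rfl with h | h
  · rw [h] at hp
    rw [← hx, hA.key_eq a p q hp haq]
  · rw [h, initialPoint_flip, haq, Option.some_inj] at hp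
    rw [hp, hx]

/-- A sequence through `s` without repetitions stays among the finitely many strands of one key, so
there is a longest one, and a longest one cannot be prolonged. This is what excludes infinite
leaves. -/
theorem Regular.exists_complete (hA : A.Regular key) (s : A.Strand) :
    ∃ l, A.Complete l ∧ s ∈ l.map Prod.fst := by
  classical
  obtain ⟨x, hx⟩ := exists_mem_strandsOfKey key s
  let Q : List A.DirStrand → Prop := fun l =>
    l.IsChain A.Consecutive ∧ (l.map Prod.fst).Nodup ∧ s ∈ l.map Prod.fst
  have ne_of_Q : ∀ l, Q l → l ≠ [] := by
    rintro _ ⟨-, -, h⟩ rfl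
    simp at h
  have bound : ∀ l, Q l → l.length ≤ (A.strandsOfKey key x).ncard := by
    intro l hl
    have hsub := (isCurve_of_isChain hl.1 (ne_of_Q l hl)).subset_of_saturated
      (hA.saturated_strandsOfKey x) hl.2.2 hx
    have h1 : (l.map Prod.fst).toFinset.card = l.length := by
      rw [List.toFinset_card_of_nodup hl.2.1, List.length_map]
    rw [← h1, ← Set.ncard_coe_finset]
    refine Set.ncard_le_ncard ?_ (hA.finite_strandsOfKey x)
    intro t ht
    exact hsub (List.mem_toFinset.1 (Finset.mem_coe.1 ht))
  obtain ⟨l, hl, hmax⟩ : ∃ l, Q l ∧ ∀ l', Q l' → l'.length ≤ l.length := by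
    by_contra! hcon
    have : ∀ n, ∃ l, Q l ∧ n ≤ l.length := by
      intro n
      induction n with
      | zero => exact ⟨[(s, true)], ⟨List.isChain_singleton _, by simp, by simp⟩, by simp⟩
      | succ n ih =>
        obtain ⟨l, hl, hn⟩ := ih
        obtain ⟨l', hl', hlt⟩ := hcon l hl
        exact ⟨l', hl', by omega⟩
    obtain ⟨l, hl, hn⟩ := this ((A.strandsOfKey key x).ncard + 1)
    have := bound l hl
    omega
  refine ⟨l, complete_of_maximal hA (ne_of_Q l hl) hl.1 hl.2.1 ?_ ?_, hl.2.2⟩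
  · intro a ha b hab
    by_contra hb
    have : Q (l ++ [b]) := by
      refine ⟨hl.1.append (List.isChain_singleton _) ?_, ?_, ?_⟩
      · intro y hy z hz
        obtain rfl : a = y := Option.mem_unique ha hy
        obtain rfl : b = z := by simpa using hz
        exact hab
      · rw [List.map_append, List.map_singleton, List.nodup_append]
        refine ⟨hl.2.1, by simp, ?_⟩
        rintro y hy z hz rfl
        simp only [List.mem_singleton] at hz
        exact hb (hz ▸ hy)
      · rw [List.map_append, List.mem_append]
        exact Or.inl hl.2.2
    have := hmax _ this
    simp at this
  · intro a ha b hab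
    by_contra hb
    have : Q (b :: l) := by
      refine ⟨List.isChain_cons.2 ⟨?_, hl.1⟩, ?_, ?_⟩
      · intro y hy
        obtain rfl : a = y := Option.mem_unique ha hy
        exact hab
      · rw [List.map_cons, List.nodup_cons]
        exact ⟨hb, hl.2.1⟩
      · rw [List.map_cons, List.mem_cons]
        exact Or.inr hl.2.2
    have := hmax _ this
    simp at this

end Chains

/-! ### Rotating and reversing the writings of a leaf -/

section Writes

variable {P : Type v} {A : System P}

theorem Leaf.nonempty (C : A.Leaf) : C.1.Nonempty := by
  obtain ⟨J, γ, ⟨j, hj⟩, -, -, h⟩ := C.2.1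
  rw [h]
  exact ⟨_, ⟨j, hj⟩, rfl⟩

theorem Writes.mem_iff {l : List A.DirStrand} {C : A.Leaf} (h : A.Writes l C) {s : A.Strand} :
    s ∈ l.map Prod.fst ↔ s ∈ C.1 := by
  rw [← h.union_eq]
  rfl

theorem Writes.rev {l : List A.DirStrand} {C : A.Leaf} (h : A.Writes l C) :
    A.Writes (A.rev l) C where
  ne_nil := by simpa [System.rev] using h.ne_nil
  consecutive := isChain_rev.2 h.consecutive
  nodup := by simpa [System.rev, Function.comp_def] using h.nodup
  union_eq := by
    rw [← h.union_eq]
    ext s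
    exact mem_map_fst_rev

theorem Writes.rotate_one {l : List A.DirStrand} {C : A.Leaf} (h : A.Writes l C)
    (hc : A.ClosesUp l) : A.Writes (l.rotate 1) C ∧ A.ClosesUp (l.rotate 1) := by
  obtain ⟨a, ha, b, hb, hab⟩ := hc
  obtain _ | ⟨c, l⟩ := l
  · simp at hb
  obtain rfl : c = b := by simpa using hb
  have hrot : (c :: l).rotate 1 = l ++ [c] := by simp
  have hch := List.isChain_cons.1 h.consecutive
  rw [hrot]
  refine ⟨⟨by simp, ?_, ?_, ?_⟩, ?_⟩
  · refine hch.2.append (List.isChain_singleton _) fun x hx y hy => ?_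
    obtain rfl : c = y := by simpa using hy
    have : x ∈ (c :: l).getLast? := by
      rw [List.getLast?_cons]
      rw [Option.mem_def] at hx
      simp [hx]
    rwa [← Option.mem_unique ha this]
  · exact ((List.perm_append_singleton c l).map Prod.fst).nodup_iff.2 h.nodup
  · rw [← h.union_eq]
    ext s
    exact ((List.perm_append_singleton c l).map Prod.fst).mem_iff
  · cases l with
    | nil =>
      exact ⟨c, by simp, c, by simp, by
        obtain rfl : c = a := by simpa using ha
        exact hab⟩
    | cons d l => exact ⟨c, List.getLast?_concat, d, by simp, hch.1 d (by simp)⟩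

theorem Writes.rotate {l : List A.DirStrand} {C : A.Leaf} (h : A.Writes l C)
    (hc : A.ClosesUp l) (k : ℕ) : A.Writes (l.rotate k) C ∧ A.ClosesUp (l.rotate k) := by
  induction k with
  | zero => simpa using ⟨h, hc⟩
  | succ k ih =>
    rw [← List.rotate_rotate]
    exact ih.1.rotate_one ih.2

theorem Writes.length_eq {l l' : List A.DirStrand} {C : A.Leaf} (h : A.Writes l C)
    (h' : A.Writes l' C) : l.length = l'.length := by
  have : (l.map Prod.fst).Perm (l'.map Prod.fst) :=
    (List.perm_ext_iff_of_nodup h.nodup h'.nodup).2 fun s => by rw [h.mem_iff, h'.mem_iff]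
  simpa using this.length_eq

theorem Complete.head?_of_initialPoint {l : List A.DirStrand} (h : A.Complete l)
    {a : A.DirStrand} (ha : a ∈ l) (hn : A.initialPoint a = none) :
    l.head? = some a ∧ ¬ A.ClosesUp l := by
  have hno : ∀ b, ¬ A.Consecutive b a := by
    rintro b ⟨-, p, -, hp⟩
    simp [hn] at hp
  obtain ⟨l₁, l₂, rfl⟩ := List.append_of_mem ha
  rcases l₁.eq_nil_or_concat with rfl | ⟨l₁, d, rfl⟩
  · refine ⟨rfl, ?_⟩
    rintro ⟨b, -, c, hc, hbc⟩
    obtain rfl : a = c := by simpa using hc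
    exact hno b hbc
  · have := h.chain
    rw [List.concat_eq_append, List.append_assoc, List.singleton_append] at this
    exact absurd (List.isChain_append_cons_cons.1 this).2.1 (hno d)

theorem forall₂_rotate {α β : Type*} {R : α → β → Prop} {l : List α} {l' : List β}
    (h : List.Forall₂ R l l') (k : ℕ) : List.Forall₂ R (l.rotate k) (l'.rotate k) := by
  induction k generalizing l l' with
  | zero => simpa using h
  | succ k ih =>
    cases h with
    | nil => simp
    | cons h hl =>
      rw [List.rotate_cons_succ, List.rotate_cons_succ]
      exact ih (List.rel_append hl (.cons h .nil))

theorem forall₂_rev {R : A.DirStrand → A.DirStrand → Prop}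
    (hR : ∀ a b, R a b → R (A.flip a) (A.flip b)) {l l' : List A.DirStrand}
    (h : List.Forall₂ R l l') : List.Forall₂ R (A.rev l) (A.rev l') := by
  rw [rev, rev, List.forall₂_reverse_iff, List.forall₂_map_left_iff, List.forall₂_map_right_iff]
  exact h.imp hR

/-- A rotated writing of a closed leaf is again a writing of it, so the shift can be absorbed into
`l'` and both cases treated alike. -/
theorem leafRel_iff {R : A.DirStrand → A.DirStrand → Prop} {C D : A.Leaf} :
    A.LeafRel R C D ↔ ∃ l l', A.Writes l C ∧ A.Writes l' D ∧
      (A.ClosesUp l ↔ A.ClosesUp l') ∧ List.Forall₂ R l l' := by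
  constructor
  · rintro ⟨l, l', hl, hl', ⟨h1, h2, h⟩ | ⟨h1, h2, k, h⟩⟩
    · exact ⟨l, l', hl, hl', iff_of_false h1 h2, h⟩
    · have := hl'.rotate h2 k
      exact ⟨l, _, hl, this.1, iff_of_true h1 this.2, h⟩
  · rintro ⟨l, l', hl, hl', hc, h⟩
    by_cases h1 : A.ClosesUp l
    · exact ⟨l, l', hl, hl', Or.inr ⟨h1, hc.1 h1, 0, by simpa using h⟩⟩
    · exact ⟨l, l', hl, hl', Or.inl ⟨h1, fun h2 => h1 (hc.2 h2), h⟩⟩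

theorem equivalence_strandParallel : Equivalence A.StrandParallel :=
  ⟨fun _ => rfl, fun h => Eq.symm h, fun h h' => Eq.trans h h'⟩

theorem equivalence_strandCoherent : Equivalence A.StrandCoherent :=
  ⟨fun _ => ⟨rfl, rfl⟩, fun h => ⟨h.1.symm, h.2.symm⟩,
    fun h h' => ⟨h.1.trans h'.1, h.2.trans h'.2⟩⟩

theorem CoherentlyParallel.parallel {C D : A.Leaf} (h : A.CoherentlyParallel C D) :
    A.Parallel C D := by
  obtain ⟨l, l', hl, hl', hc, h⟩ := leafRel_iff.1 h
  exact leafRel_iff.2 ⟨l, l', hl, hl', hc, h.imp fun _ _ => And.left⟩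

end Writes

/-! ### Leaves as complete sequences; uniqueness of writings -/

section Leaves

variable {P : Type v} [LinearOrder P] {X : Type u} {A : System P} {key : P → X}

theorem Complete.maximal (hA : A.Regular key) {l : List A.DirStrand} (h : A.Complete l) :
    Maximal A.IsCurve {s | s ∈ l.map Prod.fst} := by
  refine ⟨isCurve_of_isChain h.chain h.ne_nil, fun C hC hle => ?_⟩
  obtain ⟨a, ha⟩ := List.exists_mem_of_ne_nil l h.ne_nil
  have ha' : a.1 ∈ {s | s ∈ l.map Prod.fst} := List.mem_map_of_mem ha
  exact hC.subset_of_saturated (h.saturated hA) (hle ha') ha'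

theorem Complete.exists_writes (hA : A.Regular key) {l : List A.DirStrand} (h : A.Complete l) :
    ∃ C, A.Writes l C :=
  ⟨⟨_, h.maximal hA⟩, h.ne_nil, h.chain, h.nodup, rfl⟩

theorem Regular.exists_complete_writes (hA : A.Regular key) (C : A.Leaf) {s : A.Strand}
    (hs : s ∈ C.1) : ∃ l, A.Complete l ∧ A.Writes l C := by
  obtain ⟨l, hl, hsl⟩ := hA.exists_complete s
  have hsub := C.2.1.subset_of_saturated (hl.saturated hA) hs hsl
  have heq := C.2.eq_of_subset (hl.maximal hA).1 hsub
  exact ⟨l, hl, hl.ne_nil, hl.chain, hl.nodup, heq.symm⟩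

theorem Leaf.saturated (hA : A.Regular key) (C : A.Leaf) : A.Saturated C.1 := by
  obtain ⟨s, hs⟩ := C.nonempty
  obtain ⟨l, hl, hw⟩ := hA.exists_complete_writes C hs
  rw [← hw.union_eq]
  exact hl.saturated hA

/-- Leaves are saturated, so a common strand forces an inclusion, which maximality turns into
equality. -/
theorem Leaf.eq_of_mem (hA : A.Regular key) {C D : A.Leaf} {s : A.Strand} (hC : s ∈ C.1)
    (hD : s ∈ D.1) : C = D := by
  have hsub := C.2.1.subset_of_saturated (D.saturated hA) hC hD
  exact Subtype.ext (C.2.eq_of_subset D.2.1 hsub)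

theorem Writes.complete (hA : A.Regular key) {l : List A.DirStrand} {C : A.Leaf}
    (h : A.Writes l C) : A.Complete l := by
  refine complete_of_maximal hA h.ne_nil h.consecutive h.nodup (fun a ha b hab => ?_)
    fun a ha b hab => ?_
  · rw [h.mem_iff]
    exact C.saturated hA a b hab (h.mem_iff.1 (List.mem_map_of_mem (List.mem_of_mem_getLast? ha)))
  · rw [h.mem_iff]
    exact ((C.saturated hA).mem_iff hab).2
      (h.mem_iff.1 (List.mem_map_of_mem (List.mem_of_mem_head? ha)))

theorem Regular.eq_of_head? (hA : A.Regular key) {l l' : List A.DirStrand}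
    (hl : l.IsChain A.Consecutive) (hl' : l'.IsChain A.Consecutive) (hh : l.head? = l'.head?)
    (hlen : l.length = l'.length) : l = l' := by
  induction l generalizing l' with
  | nil => exact (List.length_eq_zero_iff.1 hlen.symm).symm
  | cons a l ih =>
    obtain _ | ⟨b, l'⟩ := l'
    · simp at hlen
    obtain rfl : a = b := by simpa using hh
    rw [List.isChain_cons] at hl hl'
    congr 1
    refine ih hl.2 hl'.2 ?_ (by simpa using hlen)
    obtain _ | ⟨c, l⟩ := l <;> obtain _ | ⟨d, l'⟩ := l'
    · rfl
    · simp at hlen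
    · simp at hlen
    · simp [hA.right_unique (hl.1 c (by simp)) (hl'.1 d (by simp))]

/-- If two sequences write the same leaf and the first contains the first member of the second,
then the second is a rotation of the first. -/
theorem Writes.eq_rotate (hA : A.Regular key) {l l' : List A.DirStrand} {C : A.Leaf}
    (h : A.Writes l C) (h' : A.Writes l' C) {a : A.DirStrand} (ha : l'.head? = some a)
    (hal : a ∈ l) : (¬ A.ClosesUp l ∧ ¬ A.ClosesUp l' ∧ l' = l) ∨
      (A.ClosesUp l ∧ A.ClosesUp l' ∧ ∃ k, l' = l.rotate k) := by
  by_cases hc : A.ClosesUp l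
  · obtain ⟨l₁, l₂, rfl⟩ := List.append_of_mem hal
    have hr := h.rotate hc l₁.length
    have heq : l' = (l₁ ++ a :: l₂).rotate l₁.length :=
      hA.eq_of_head? h'.consecutive hr.1.consecutive (by simp [ha]) (h'.length_eq hr.1)
    exact Or.inr ⟨hc, heq ▸ hr.2, _, heq⟩
  · have hl := h.complete hA
    by_cases hc' : A.ClosesUp l'
    -- The nonclosed `l` begins on a free side. Its first strand also occurs in `l'` or in the
    -- reversal of `l'`, where nothing can precede it; so `l'` cannot be closed.
    · exfalso
      obtain ⟨b, hb⟩ := Option.isSome_iff_exists.1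
        (List.isSome_head?.2 h.ne_nil)
      have hb0 := (hl.ends.resolve_left hc).1 b hb
      have hbl : b.1 ∈ l'.map Prod.fst :=
        h'.mem_iff.2 (h.mem_iff.1 (List.mem_map_of_mem (List.mem_of_mem_head? hb)))
      obtain ⟨c, hcl, hcb⟩ := List.mem_map.1 hbl
      rcases eq_or_eq_flip hcb.symm with rfl | rfl
      · exact ((h'.complete hA).head?_of_initialPoint hcl hb0).2 hc'
      · exact ((h'.complete hA).rev.head?_of_initialPoint (mem_rev.2 (by simpa using hcl))
          hb0).2 hc'.rev
    · have ha0 := ((h'.complete hA).ends.resolve_left hc').1 a ha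
      have := hl.head?_of_initialPoint hal ha0
      exact Or.inl ⟨hc, hc', hA.eq_of_head? h'.consecutive h.consecutive (ha.trans this.1.symm)
        (h'.length_eq h)⟩

theorem Writes.eq_rotate_or_rev (hA : A.Regular key) {l l' : List A.DirStrand} {C : A.Leaf}
    (h : A.Writes l C) (h' : A.Writes l' C) : ∃ m, (m = l ∨ m = A.rev l) ∧
      ((¬ A.ClosesUp m ∧ ¬ A.ClosesUp l' ∧ l' = m) ∨
        (A.ClosesUp m ∧ A.ClosesUp l' ∧ ∃ k, l' = m.rotate k)) := by
  obtain ⟨a, ha⟩ := Option.isSome_iff_exists.1 (List.isSome_head?.2 h'.ne_nil)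
  have hal : a.1 ∈ l.map Prod.fst :=
    h.mem_iff.2 (h'.mem_iff.1 (List.mem_map_of_mem (List.mem_of_mem_head? ha)))
  obtain ⟨c, hcl, hca⟩ := List.mem_map.1 hal
  rcases eq_or_eq_flip hca.symm with rfl | rfl
  · exact ⟨l, Or.inl rfl, h.eq_rotate hA h' ha hcl⟩
  · exact ⟨A.rev l, Or.inr rfl, h.rev.eq_rotate hA h' ha (mem_rev.2 (by simpa using hcl))⟩

end Leaves

/-! ### Parallelity is an equivalence relation -/

section Relation

variable {P : Type v} [LinearOrder P] {X : Type u} {A : System P} {key : P → X}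
  {R : A.DirStrand → A.DirStrand → Prop}

/-- The writings `l'` and `m` of `D` differ by a reversal and a rotation; applying the same
operations to `l` keeps the matching. Transitivity uses this to align the two writings of the middle
leaf. -/
theorem exists_writes_of_forall₂ (hA : A.Regular key)
    (hR : ∀ a b, R a b → R (A.flip a) (A.flip b)) {C D : A.Leaf} {l l' m : List A.DirStrand}
    (hl : A.Writes l C) (hl' : A.Writes l' D) (hm : A.Writes m D)
    (hc : A.ClosesUp l ↔ A.ClosesUp l') (h : List.Forall₂ R l l') :
    ∃ n, A.Writes n C ∧ (A.ClosesUp n ↔ A.ClosesUp m) ∧ List.Forall₂ R n m := by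
  obtain ⟨l₁, hl₁, hcase⟩ := hl'.eq_rotate_or_rev hA hm
  obtain ⟨n, hn, hcn, hnl⟩ : ∃ n, A.Writes n C ∧ (A.ClosesUp n ↔ A.ClosesUp l₁) ∧
      List.Forall₂ R n l₁ := by
    rcases hl₁ with rfl | rfl
    · exact ⟨l, hl, hc, h⟩
    · exact ⟨A.rev l, hl.rev, by rwa [closesUp_rev, closesUp_rev], forall₂_rev hR h⟩
  rcases hcase with ⟨-, -, rfl⟩ | ⟨h1, h2, k, rfl⟩
  · exact ⟨n, hn, hcn, hnl⟩
  · have := hn.rotate (hcn.2 h1) k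
    exact ⟨_, this.1, iff_of_true this.2 h2, forall₂_rotate hnl k⟩

theorem Regular.equivalence_leafRel (hA : A.Regular key) (hE : Equivalence R)
    (hR : ∀ a b, R a b → R (A.flip a) (A.flip b)) : Equivalence (A.LeafRel R) where
  refl C := by
    obtain ⟨s, hs⟩ := C.nonempty
    obtain ⟨l, -, hl⟩ := hA.exists_complete_writes C hs
    exact leafRel_iff.2 ⟨l, l, hl, hl, Iff.rfl, List.forall₂_same.2 fun a _ => hE.refl a⟩
  symm h := by
    obtain ⟨l, l', hl, hl', hc, h⟩ := leafRel_iff.1 h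
    exact leafRel_iff.2 ⟨l', l, hl', hl, hc.symm, (h.imp fun _ _ => hE.symm).flip⟩
  trans h h' := by
    obtain ⟨l, l', hl, hl', hc, h⟩ := leafRel_iff.1 h
    obtain ⟨m, m', hm, hm', hc', h'⟩ := leafRel_iff.1 h'
    obtain ⟨n, hn, hcn, hnm⟩ := exists_writes_of_forall₂ hA hR hl hl' hm hc h
    refine leafRel_iff.2 ⟨n, m', hn, hm', hcn.trans hc', ?_⟩
    have hlen := hnm.length_eq.trans h'.length_eq
    rw [List.forall₂_iff_get] at hnm h' ⊢
    exact ⟨hlen, fun i h1 h2 =>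
      hE.trans (hnm.2 i h1 (hnm.1 ▸ h1)) (h'.2 i (hnm.1 ▸ h1) h2)⟩

end Relation

/-! ### Points of a leaf on the segment -/

section Points

variable {P : Type v} {A : System P}

/-- The points of the segment that lie on a leaf. -/
def points (A : System P) (C : A.Leaf) : Set P :=
  {p | ∃ a, a.1 ∈ C.1 ∧ A.initialPoint a = some p}

theorem points_nonempty (C : A.Leaf) : (A.points C).Nonempty := by
  obtain ⟨s, hs⟩ := C.nonempty
  cases h : A.initialPoint (s, true) with
  | some p => exact ⟨p, _, hs, h⟩
  | none =>
    obtain ⟨p, hp⟩ := exists_terminalPoint h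
    exact ⟨p, A.flip (s, true), hs, by simpa using hp⟩

theorem terminalPoint_mem_points {C : A.Leaf} {a : A.DirStrand} {q : P} (ha : a.1 ∈ C.1)
    (hq : A.terminalPoint a = some q) : q ∈ A.points C :=
  ⟨A.flip a, ha, by simpa using hq⟩

end Points

/-! ### Neighbours in a finite subset of a linear order -/

section Neighbours

variable {P : Type v} [LinearOrder P] {Q : Set P}

/-- `p < q` are neighbours in the set `Q`. -/
def Adjacent (Q : Set P) (p q : P) : Prop :=
  p ∈ Q ∧ q ∈ Q ∧ p < q ∧ ∀ r ∈ Q, p < r → ¬ r < q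

theorem Adjacent.right_unique {p q r : P} (h : Adjacent Q p q) (h' : Adjacent Q p r) : q = r :=
  le_antisymm (not_lt.1 (h.2.2.2 r h'.2.1 h'.2.2.1)) (not_lt.1 (h'.2.2.2 q h.2.1 h.2.2.1))

theorem Adjacent.left_unique {p q r : P} (h : Adjacent Q p q) (h' : Adjacent Q r q) : p = r :=
  le_antisymm (not_lt.1 fun hlt => h'.2.2.2 p h.1 hlt h.2.2.1)
    (not_lt.1 fun hlt => h.2.2.2 r h'.1 hlt h'.2.2.1)

theorem exists_adjacent_right (hQ : Q.Finite) {p q : P} (hp : p ∈ Q) (hq : q ∈ Q)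
    (hpq : p < q) : ∃ r, Adjacent Q p r ∧ r ≤ q := by
  obtain ⟨r, ⟨hr, hpr⟩, hmin⟩ := (hQ.subset (Set.sep_subset Q (p < ·))).exists_minimal ⟨q, hq, hpq⟩
  have hle : ∀ x ∈ Q, p < x → r ≤ x := fun x hx hpx =>
    (le_total r x).elim id fun h => hmin ⟨hx, hpx⟩ h
  exact ⟨r, ⟨hp, hr, hpr, fun x hx hpx => not_lt.2 (hle x hx hpx)⟩, hle q hq hpq⟩

theorem exists_adjacent_left (hQ : Q.Finite) {p q : P} (hp : p ∈ Q) (hq : q ∈ Q)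
    (hqp : q < p) : ∃ r, Adjacent Q r p ∧ q ≤ r := by
  obtain ⟨r, ⟨hr, hpr⟩, hmax⟩ := (hQ.subset (Set.sep_subset Q (· < p))).exists_maximal ⟨q, hq, hqp⟩
  have hle : ∀ x ∈ Q, x < p → x ≤ r := fun x hx hpx =>
    (le_total x r).elim id fun h => hmax ⟨hx, hpx⟩ h
  exact ⟨r, ⟨hr, hp, hpr, fun x hx hrx hxp => not_lt.2 (hle x hx hxp) hrx⟩, hle q hq hqp⟩

/-- `p'` is the next member of `Q` after `p` (`true`) or before `p` (`false`). -/
def Neighbour (Q : Set P) : Bool → P → P → Prop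
  | true, p, p' => Adjacent Q p p'
  | false, p, p' => Adjacent Q p' p

theorem Neighbour.right_unique {c : Bool} {p q r : P} (h : Neighbour Q c p q)
    (h' : Neighbour Q c p r) : q = r := by
  cases c
  · exact Adjacent.left_unique h h'
  · exact Adjacent.right_unique h h'

theorem Neighbour.left_unique {c : Bool} {p q r : P} (h : Neighbour Q c p q)
    (h' : Neighbour Q c r q) : p = r := by
  cases c
  · exact Adjacent.right_unique h h'
  · exact Adjacent.left_unique h h'

theorem Neighbour.mem {c : Bool} {p q : P} (h : Neighbour Q c p q) : q ∈ Q := by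
  cases c
  · exact h.1
  · exact h.2.1

end Neighbours

/-! ### Shifting leaves, and the bound on the number of classes -/

section Shift

variable {P : Type v} [LinearOrder P] {X : Type u} {A : System P} {key : P → X} {Q : Set P}

/-- The point `p` is the last (`true`) or the first (`false`) point of `Q` on the segment at which
the directed lines and arches coherent with `a` start. -/
def IsExtreme (A : System P) (Q : Set P) (a : A.DirStrand) (c : Bool) (p : P) : Prop :=
  ∀ b q, A.StrandCoherent a b → A.initialPoint b = some q → q ∈ Q →
    if c then q ≤ p else p ≤ q

/-- A non-extreme point has a further point of `Q` on its segment; the neighbour of `p` lies between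
the two, so it is on the same segment by convexity. -/
theorem Regular.exists_neighbour (hA : A.Regular key) (hQ : Q.Finite) {a : A.DirStrand} {p : P}
    {c : Bool} (ha : A.initialPoint a = some p) (hp : p ∈ Q) (h : ¬ A.IsExtreme Q a c p) :
    ∃ b p', A.StrandCoherent a b ∧ A.initialPoint b = some p' ∧ Neighbour Q c p p' := by
  simp only [IsExtreme, not_forall] at h
  obtain ⟨b, q, hab, hb, hq, h⟩ := h
  cases c
  · obtain ⟨r, hr, hqr⟩ := exists_adjacent_left hQ hp hq (by simpa using h)
    obtain ⟨d, hd, hbd⟩ := hA.convex b a q r p (equivalence_strandCoherent.symm hab) hb ha hqr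
      hr.2.2.1.le
    exact ⟨d, r, equivalence_strandCoherent.trans hab hbd, hd, hr⟩
  · obtain ⟨r, hr, hqr⟩ := exists_adjacent_right hQ hp hq (by simpa using h)
    obtain ⟨d, hd, had⟩ := hA.convex a b p r q hab ha hb hr.2.2.1.le hqr
    exact ⟨d, r, had, hd, hr⟩

/-- The set `Q` contains with each endpoint of an arch the other one. -/
def Invariant (A : System P) (Q : Set P) : Prop :=
  ∀ a p q, A.initialPoint a = some p → A.terminalPoint a = some q → p ∈ Q → q ∈ Q

/-- A point of `Q` strictly between the terminal points would, by convexity, be the end of an arch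
of the same band. Its other end is in `Q` by invariance and, since the band reverses the order,
strictly between `p` and `p'`. -/
theorem Regular.adjacent_terminal (hA : A.Regular key) (hQ : A.Invariant Q) {a b : A.DirStrand}
    {p p' q q' : P} (hab : A.StrandCoherent a b) (ha : A.initialPoint a = some p)
    (hb : A.initialPoint b = some p') (hqa : A.terminalPoint a = some q)
    (hqb : A.terminalPoint b = some q') (h : Adjacent Q p p') : Adjacent Q q' q := by
  have hlt := hA.anti a b p p' q q' hab ha hb hqa hqb h.2.2.1
  refine ⟨hQ b p' q' hb hqb h.2.1, hQ a p q ha hqa h.1, hlt, fun r hr h1 h2 => ?_⟩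
  obtain ⟨c, hc, hbc⟩ := hA.convex (A.flip b) (A.flip a) q' r q
    (equivalence_strandCoherent.symm hab).flip (by simpa using hqb) (by simpa using hqa)
    h1.le h2.le
  obtain ⟨r', hr'⟩ : ∃ r', A.terminalPoint c = some r' := by
    rw [← Option.ne_none_iff_exists']
    intro hn
    rw [← initialPoint_flip] at hn
    have := initialPoint_eq_none_of_coherent (equivalence_strandCoherent.symm hbc.flip) hn
    simp [hb] at this
  have hr'Q := hQ c r r' hc hr' hr
  have h3 := hA.anti (A.flip b) c q' r p' r' hbc (by simpa using hqb) hc (by simpa using hb) hr' h1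
  have h4 := hA.anti c (A.flip a) r q r' p
    (equivalence_strandCoherent.trans (equivalence_strandCoherent.symm hbc)
      (equivalence_strandCoherent.symm hab).flip) hc (by simpa using hqa) hr'
    (by simpa using ha) h2
  exact h.2.2.2 r' hr'Q h4 h3

theorem Regular.neighbour_terminal (hA : A.Regular key) (hQ : A.Invariant Q) {a b : A.DirStrand}
    {p p' q q' : P} {c : Bool} (hab : A.StrandCoherent a b) (ha : A.initialPoint a = some p)
    (hb : A.initialPoint b = some p') (hqa : A.terminalPoint a = some q)
    (hqb : A.terminalPoint b = some q') (h : Neighbour Q c p p') : Neighbour Q (!c) q q' := by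
  cases c
  · exact hA.adjacent_terminal hQ (equivalence_strandCoherent.symm hab) hb ha hqb hqa h
  · exact hA.adjacent_terminal hQ hab ha hb hqa hqb h

/-- The directed line or arch `b` is the neighbour of `a` in its band, among those with endpoints in
`Q`, on the side given by `c` at the initial point. -/
structure IsShift (A : System P) (Q : Set P) (c : Bool) (a b : A.DirStrand) : Prop where
  coherent : A.StrandCoherent a b
  initial : ∀ p, A.initialPoint a = some p → ∃ p', A.initialPoint b = some p' ∧ Neighbour Q c p p'
  terminal : ∀ q, A.terminalPoint a = some q →
    ∃ q', A.terminalPoint b = some q' ∧ Neighbour Q (!c) q q'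

theorem IsShift.flip {c : Bool} {a b : A.DirStrand} (h : A.IsShift Q c a b) :
    A.IsShift Q (!c) (A.flip a) (A.flip b) where
  coherent := h.coherent.flip
  initial p hp := by simpa using h.terminal p (by simpa using hp)
  terminal q hq := by simpa using h.initial q (by simpa using hq)

/-- At the common point both strands are shifted to the same side, and a point has at most one
neighbour in `Q` on each side; so the shifted strands meet again. -/
theorem IsShift.consecutive {c : Bool} {a b a' b' : A.DirStrand} (ha : A.IsShift Q c a a')
    (hb : A.IsShift Q (!c) b b') (h : A.Consecutive a b) : A.Consecutive a' b' := by
  obtain ⟨hab, p, hp, hq⟩ := h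
  obtain ⟨q', hq', hn⟩ := ha.terminal p hp
  obtain ⟨p', hp', hn'⟩ := hb.initial p hq
  refine ⟨?_, q', hq', by rw [hp', hn.right_unique hn']⟩
  rwa [← isLeft_eq_of_band_eq ha.coherent.1, ← isLeft_eq_of_band_eq hb.coherent.1]

theorem IsShift.eq_of_initialPoint (hA : A.Regular key) {c : Bool} {a b d : A.DirStrand}
    (ha : A.IsShift Q c a d) (hb : A.IsShift Q c b d) {p : P} (hp : A.initialPoint a = some p) :
    a = b := by
  obtain ⟨p', hp', hn⟩ := ha.initial p hp
  obtain ⟨q, hq⟩ : ∃ q, A.initialPoint b = some q := by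
    rw [← Option.ne_none_iff_exists']
    intro h
    simp [initialPoint_eq_none_of_coherent hb.coherent h] at hp'
  obtain ⟨q', hq', hn'⟩ := hb.initial q hq
  obtain rfl : p' = q' := by simpa [hp'] using hq'
  obtain rfl := hn.left_unique hn'
  refine hA.unique a b p ?_ hp hq
  exact isLeft_eq_of_band_eq (ha.coherent.1.trans hb.coherent.1.symm)

theorem IsShift.left_unique (hA : A.Regular key) {c : Bool} {a b d : A.DirStrand}
    (ha : A.IsShift Q c a d) (hb : A.IsShift Q c b d) : a = b := by
  cases h : A.initialPoint a with
  | some p => exact ha.eq_of_initialPoint hA hb h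
  | none =>
    obtain ⟨p, hp⟩ := exists_terminalPoint h
    have := ha.flip.eq_of_initialPoint hA hb.flip (p := p) (by simpa using hp)
    simpa using congrArg A.flip this

theorem Regular.exists_isShift_of_initialPoint (hA : A.Regular key) (hQ : Q.Finite)
    (hinv : A.Invariant Q) {c : Bool} {a : A.DirStrand} {p : P} (ha : A.initialPoint a = some p)
    (hp : p ∈ Q) (h : ¬ A.IsExtreme Q a c p) : ∃ b, A.IsShift Q c a b := by
  obtain ⟨b, p', hab, hb, hn⟩ := hA.exists_neighbour hQ ha hp h
  refine ⟨b, hab, fun q hq => ⟨p', hb, ?_⟩, fun q hq => ?_⟩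
  · obtain rfl : p = q := by simpa [ha] using hq
    exact hn
  · obtain ⟨q', hq'⟩ : ∃ q', A.terminalPoint b = some q' := by
      rw [← Option.ne_none_iff_exists']
      intro h
      rw [← initialPoint_flip] at h
      have := initialPoint_eq_none_of_coherent (equivalence_strandCoherent.symm hab.flip) h
      simp [hq] at this
    exact ⟨q', hq', hA.neighbour_terminal hinv hab ha hb hq hq' hn⟩

theorem Regular.mem_of_mem_points (hA : A.Regular key) {C : A.Leaf} {p : P}
    (hp : p ∈ A.points C) {a : A.DirStrand} (ha : A.initialPoint a = some p) : a.1 ∈ C.1 := by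
  obtain ⟨b, hb, hbp⟩ := hp
  by_cases h : b.1.isLeft = a.1.isLeft
  · rwa [← hA.unique b a p h hbp ha]
  · exact C.saturated hA (A.flip b) a ⟨h, p, by simpa using hbp, ha⟩ hb

theorem Regular.finite_points (hA : A.Regular key) (C : A.Leaf) : (A.points C).Finite := by
  obtain ⟨s, hs⟩ := C.nonempty
  obtain ⟨l, -, hl⟩ := hA.exists_complete_writes C hs
  -- The reversed list is added because `points` allows either direction of a strand.
  refine ((l ++ A.rev l).filterMap A.initialPoint).finite_toSet.subset ?_
  rintro p ⟨a, ha, hp⟩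
  obtain ⟨b, hb, hba⟩ := List.mem_map.1 (hl.mem_iff.2 ha)
  refine List.mem_filterMap.2 ⟨a, ?_, hp⟩
  rcases eq_or_eq_flip hba with rfl | rfl
  · simp [hb]
  · simp [hb]

theorem Regular.exists_isShift (hA : A.Regular key) (hQ : Q.Finite) (hinv : A.Invariant Q)
    {C : A.Leaf} (hCQ : A.points C ⊆ Q)
    (hext : ∀ a p c, p ∈ A.points C → A.initialPoint a = some p → ¬ A.IsExtreme Q a c p)
    {a : A.DirStrand} (ha : a.1 ∈ C.1) (c : Bool) : ∃ b, A.IsShift Q c a b := by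
  cases h : A.initialPoint a with
  | some p =>
    have hp : p ∈ A.points C := ⟨a, ha, h⟩
    exact hA.exists_isShift_of_initialPoint hQ hinv h (hCQ hp) (hext a p c hp h)
  | none =>
    obtain ⟨p, hp⟩ := exists_terminalPoint h
    have hpC := terminalPoint_mem_points ha hp
    -- A line that comes from a free side is shifted through its reversal, where the sides are
    -- interchanged.
    rw [← initialPoint_flip] at hp
    obtain ⟨b, hb⟩ := hA.exists_isShift_of_initialPoint hQ hinv hp (hCQ hpC)
      (hext (A.flip a) p (!c) hpC hp)
    exact ⟨A.flip b, by simpa using hb.flip⟩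

/-- A leaf none of whose points is extreme can be shifted to a coherently parallel leaf. -/
theorem Regular.exists_shifted_leaf (hA : A.Regular key) (hQ : Q.Finite) (hinv : A.Invariant Q)
    {C : A.Leaf} (hCQ : A.points C ⊆ Q)
    (hext : ∀ a p c, p ∈ A.points C → A.initialPoint a = some p → ¬ A.IsExtreme Q a c p)
    {l : List A.DirStrand} (hl : A.Writes l C) : ∃ D : A.Leaf, A.CoherentlyParallel C D ∧
      ∀ a ∈ l, ∃ b, b.1 ∈ D.1 ∧ A.IsShift Q a.1.isLeft a b := by
  -- The side is `isLeft`: rightwards at the start of upper strands, leftwards at the start of lower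
  -- ones. This is always the right-hand side of the directed curve, and it alternates as
  -- `IsShift.consecutive` requires.
  have hex : ∀ a, ∃ b, a.1 ∈ C.1 → A.IsShift Q a.1.isLeft a b := fun a => by
    by_cases ha : a.1 ∈ C.1
    · obtain ⟨b, hb⟩ := hA.exists_isShift hQ hinv hCQ hext ha a.1.isLeft
      exact ⟨b, fun _ => hb⟩
    · exact ⟨a, fun h => absurd h ha⟩
  choose g hg' using hex
  have hg : ∀ a ∈ l, A.IsShift Q a.1.isLeft a (g a) := fun a ha =>
    hg' a (hl.mem_iff.1 (List.mem_map_of_mem ha))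
  have hstep : ∀ a ∈ l, ∀ b ∈ l, A.Consecutive a b → A.Consecutive (g a) (g b) := by
    intro a ha b hb hab
    refine (hg a ha).consecutive ?_ hab
    have : (!a.1.isLeft) = b.1.isLeft := by
      have := hab.1
      revert this
      cases a.1.isLeft <;> cases b.1.isLeft <;> simp
    rw [this]
    exact hg b hb
  have hchain : (l.map g).IsChain A.Consecutive := by
    rw [List.isChain_map]
    exact hl.consecutive.imp_of_mem_imp fun a b ha hb => hstep a ha b hb
  have hnodup : (l.map g).Nodup := by
    refine (List.Nodup.of_map _ hl.nodup).map_on fun a ha b hb hab => ?_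
    have h1 := hg a ha
    have h2 := hg b hb
    have hside : a.1.isLeft = b.1.isLeft := by
      rw [isLeft_eq_of_band_eq h1.coherent.1, isLeft_eq_of_band_eq h2.coherent.1, hab]
    rw [← hab, ← hside] at h2
    exact h1.left_unique hA h2
  have hcl : A.ClosesUp l → A.ClosesUp (l.map g) := by
    rintro ⟨a, ha, b, hb, hab⟩
    refine ⟨g a, ?_, g b, ?_, hstep a (List.mem_of_mem_getLast? ha) b
      (List.mem_of_mem_head? hb) hab⟩
    · rw [Option.mem_def] at ha
      simp [ha]
    · rw [Option.mem_def] at hb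
      simp [hb]
  have hhead : ¬ A.ClosesUp l → ∀ a ∈ (l.map g).head?, A.initialPoint a = none := by
    intro hc a ha
    obtain ⟨b, hb, rfl⟩ : ∃ b, l.head? = some b ∧ g b = a := by simpa using ha
    exact initialPoint_eq_none_of_coherent (hg b (List.mem_of_mem_head? hb)).coherent
      (((hl.complete hA).ends.resolve_left hc).1 b hb)
  have hlast : ¬ A.ClosesUp l → ∀ a ∈ (l.map g).getLast?, A.terminalPoint a = none := by
    intro hc a ha
    obtain ⟨b, hb, rfl⟩ : ∃ b, l.getLast? = some b ∧ g b = a := by simpa using ha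
    rw [← initialPoint_flip]
    refine initialPoint_eq_none_of_coherent
      (hg b (List.mem_of_mem_getLast? hb)).coherent.flip ?_
    rw [initialPoint_flip]
    exact ((hl.complete hA).ends.resolve_left hc).2 b hb
  have hcomplete : A.Complete (l.map g) := by
    -- Injectivity of the shift only excludes repeated directed strands; that the shifted chain does
    -- not use a strand in both directions is the content of `nodup_map_fst`.
    refine ⟨by simpa using hl.ne_nil, hchain, hA.nodup_map_fst hchain hnodup, ?_⟩
    by_cases hc : A.ClosesUp l
    · exact Or.inl (hcl hc)
    · exact Or.inr ⟨hhead hc, hlast hc⟩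
  obtain ⟨D, hD⟩ := hcomplete.exists_writes hA
  refine ⟨D, leafRel_iff.2 ⟨l, l.map g, hl, hD, ⟨hcl, fun h => ?_⟩, ?_⟩, fun a ha =>
    ⟨g a, hD.mem_iff.1 (List.mem_map_of_mem (List.mem_map_of_mem ha)), hg a ha⟩⟩
  -- If `l` is not closed, its image starts on a free side, so nothing can lead into its first
  -- strand.
  · by_contra hc
    obtain ⟨a, -, b, hb, -, p, -, hp⟩ := h
    simp [hhead hc b hb] at hp
  · rw [List.forall₂_map_right_iff, List.forall₂_same]
    exact fun a ha => (hg a ha).coherent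

/-- In a finite set of leaves that are pairwise not coherently parallel, every leaf runs through an
extreme point of a segment to which a band is glued. -/
theorem Regular.exists_isExtreme (hA : A.Regular key) {S : Set A.Leaf} (hS : S.Finite)
    (hpar : ∀ C ∈ S, ∀ D ∈ S, A.CoherentlyParallel C D → C = D) {C : A.Leaf} (hC : C ∈ S) :
    ∃ a p c, p ∈ A.points C ∧ A.initialPoint a = some p ∧
      A.IsExtreme (⋃ D ∈ S, A.points D) a c p := by
  by_contra! hext
  set Q := ⋃ D ∈ S, A.points D with hQdef
  have hQ : Q.Finite := hS.biUnion fun D _ => hA.finite_points D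
  have hinv : A.Invariant Q := by
    intro a p q ha hq hp
    simp only [hQdef, Set.mem_iUnion] at hp ⊢
    obtain ⟨D, hD, hpD⟩ := hp
    exact ⟨D, hD, terminalPoint_mem_points (hA.mem_of_mem_points hpD ha) hq⟩
  have hCQ : A.points C ⊆ Q := Set.subset_biUnion_of_mem hC
  obtain ⟨p, hp, hmax⟩ := (hA.finite_points C).exists_maximal (points_nonempty C)
  -- An upper strand is chosen at the rightmost point `p` because its initial point is shifted to
  -- the right, beyond every point of `C`.
  obtain ⟨a, hal, hap⟩ := hA.exists_initial p true
  have haC := hA.mem_of_mem_points hp hap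
  obtain ⟨l, hl, hla⟩ : ∃ l, A.Writes l C ∧ a ∈ l := by
    obtain ⟨l, -, hl⟩ := hA.exists_complete_writes C haC
    obtain ⟨b, hb, hba⟩ := List.mem_map.1 (hl.mem_iff.2 haC)
    rcases eq_or_eq_flip hba with rfl | rfl
    · exact ⟨l, hl, hb⟩
    · exact ⟨A.rev l, hl.rev, mem_rev.2 hb⟩
  obtain ⟨D, hCD, hD⟩ := hA.exists_shifted_leaf hQ hinv hCQ hext hl
  obtain ⟨b, hbD, hb⟩ := hD a hla
  obtain ⟨p', hp', hn⟩ := hb.initial p hap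
  have hpQ : p' ∈ Q := hn.mem
  rw [hal] at hn
  simp only [hQdef, Set.mem_iUnion] at hpQ
  obtain ⟨E, hE, hpE⟩ := hpQ
  obtain rfl := Leaf.eq_of_mem hA hbD (hA.mem_of_mem_points hpE hp')
  obtain rfl := hpar C hC D hE hCD
  exact absurd (hmax ⟨b, hbD, hp'⟩ hn.2.2.1.le) (not_le.2 hn.2.2.1)

theorem IsExtreme.eq {a b : A.DirStrand} {c : Bool} {p q : P} (ha : A.IsExtreme Q a c p)
    (hb : A.IsExtreme Q b c q) (hab : A.StrandCoherent a b) (hap : A.initialPoint a = some p)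
    (hbq : A.initialPoint b = some q) (hp : p ∈ Q) (hq : q ∈ Q) : p = q := by
  have h1 := ha b q hab hbq hq
  have h2 := hb a p (equivalence_strandCoherent.symm hab) hap hp
  cases c
  · exact le_antisymm (by simpa using h1) (by simpa using h2)
  · exact le_antisymm (by simpa using h2) (by simpa using h1)

/-- Assign to each leaf the band, the direction and the end (first or last) of an extreme point on
it. These data determine the point, and the point determines the leaf. -/
theorem Regular.ncard_le (hA : A.Regular key) {S : Set A.Leaf} (hS : S.Finite)
    (hpar : ∀ C ∈ S, ∀ D ∈ S, A.CoherentlyParallel C D → C = D) :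
    S.ncard ≤ Nat.card (A.Band × Bool × Bool) := by
  have := hA.finite_band
  have hex : ∀ C : S, ∃ t : A.Band × Bool × Bool, ∃ a p, p ∈ A.points C.1 ∧
      A.initialPoint a = some p ∧ A.IsExtreme (⋃ D ∈ S, A.points D) a t.2.2 p ∧
      A.band a.1 = t.1 ∧ a.2 = t.2.1 := by
    intro C
    obtain ⟨a, p, c, hp, ha, h⟩ := hA.exists_isExtreme hS hpar C.2
    exact ⟨(A.band a.1, a.2, c), a, p, hp, ha, h, rfl, rfl⟩
  choose f hf using hex
  refine Nat.card_le_card_of_injective f fun C D hCD => ?_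
  obtain ⟨a, p, hp, hap, ha, h1, h2⟩ := hf C
  obtain ⟨b, q, hq, hbq, hb, h3, h4⟩ := hf D
  rw [← hCD] at hb h3 h4
  have hab : A.StrandCoherent a b := ⟨h1.trans h3.symm, h2.trans h4.symm⟩
  obtain rfl := ha.eq hb hab hap hbq (Set.mem_biUnion C.2 hp) (Set.mem_biUnion D.2 hq)
  exact Subtype.ext (Leaf.eq_of_mem hA (hA.mem_of_mem_points hp hap)
    (hA.mem_of_mem_points hq hap))

theorem Regular.equivalence_parallel (hA : A.Regular key) : Equivalence A.Parallel :=
  hA.equivalence_leafRel equivalence_strandParallel fun _ _ h => h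

theorem Regular.equivalence_coherentlyParallel (hA : A.Regular key) :
    Equivalence A.CoherentlyParallel :=
  hA.equivalence_leafRel equivalence_strandCoherent fun _ _ h => h.flip

theorem Regular.finite_quot_coherentlyParallel (hA : A.Regular key) :
    Finite (Quot A.CoherentlyParallel) := by
  classical
  by_contra hinf
  rw [not_finite_iff_infinite] at hinf
  obtain ⟨s, hs⟩ := Infinite.exists_subset_card_eq (Quot A.CoherentlyParallel)
    (Nat.card (A.Band × Bool × Bool) + 1)
  have hout : Function.Injective (Quot.out : Quot A.CoherentlyParallel → A.Leaf) :=
    Function.LeftInverse.injective Quot.out_eq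
  -- Chosen representatives of distinct classes are not coherently parallel, so `ncard_le` applies
  -- to them.
  have hle := hA.ncard_le (S := Quot.out '' (s : Set (Quot A.CoherentlyParallel)))
    (s.finite_toSet.image _) (by
      rintro _ ⟨x, -, rfl⟩ _ ⟨y, -, rfl⟩ h
      rw [← Quot.out_eq x, ← Quot.out_eq y, Quot.sound h])
  rw [Set.ncard_image_of_injective _ hout, Set.ncard_coe_finset, hs] at hle
  omega

theorem Regular.finite_quot_parallel (hA : A.Regular key) : Finite (Quot A.Parallel) := by
  have := hA.finite_quot_coherentlyParallel
  refine Finite.of_surjective (Quot.map id fun _ _ h => h.parallel :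
    Quot A.CoherentlyParallel → Quot A.Parallel) ?_
  rintro ⟨C⟩
  exact ⟨Quot.mk _ C, rfl⟩

end Shift

end System

/-! ### Positions in concatenations; letters of tame words -/

namespace Word

variable {X : Type u} {ι : Type} [LinearOrder ι] [Finite ι] {w : Word.{u, v} X}
  {f : ι → Word.{u, v} X}

/-- The factors of a word written as a concatenation. -/
abbrev factors (_ : WordIso w (concat f)) : ι → Word.{u, v} X := f

/-- The position of a word given by a position of a factor of a concatenation. -/
def factorPos (e : WordIso w (concat f)) (c : ι) (x : (f c).Pos) : w.Pos :=
  e.toOrderIso.symm (concatPos f c x)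

theorem factorPos_injective (e : WordIso w (concat f)) :
    Function.Injective (fun y : Σ c, (f c).Pos => factorPos e y.1 y.2) := by
  rintro ⟨c, x⟩ ⟨c', x'⟩ h
  exact toLex.injective (e.toOrderIso.symm.injective h)

theorem exists_factorPos (e : WordIso w (concat f)) (p : w.Pos) :
    ∃ c x, factorPos e c x = p :=
  ⟨(ofLex (e.toOrderIso p)).1, (ofLex (e.toOrderIso p)).2, e.toOrderIso.symm_apply_apply p⟩

theorem factorPos_lt_iff (e : WordIso w (concat f)) {c : ι} {x y : (f c).Pos} :
    factorPos e c x < factorPos e c y ↔ x < y := by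
  rw [factorPos, factorPos, e.toOrderIso.symm.lt_iff_lt]
  refine Sigma.Lex.lt_def.trans ⟨?_, fun h => Or.inr ⟨rfl, h⟩⟩
  rintro (h | ⟨_, h⟩)
  · exact absurd h (lt_irrefl _)
  · exact h

theorem factorPos_le_iff (e : WordIso w (concat f)) {c : ι} {x y : (f c).Pos} :
    factorPos e c x ≤ factorPos e c y ↔ x ≤ y := by
  rw [← not_lt, ← not_lt, factorPos_lt_iff]

theorem exists_factorPos_between (e : WordIso w (concat f)) {c : ι} {x y : (f c).Pos} {p : w.Pos}
    (hx : factorPos e c x ≤ p) (hy : p ≤ factorPos e c y) :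
    ∃ z, factorPos e c z = p ∧ x ≤ z ∧ z ≤ y := by
  obtain ⟨d, z, rfl⟩ := exists_factorPos e p
  have hx' := Sigma.Lex.le_def.1 (e.toOrderIso.symm.le_iff_le.1 hx)
  have hy' := Sigma.Lex.le_def.1 (e.toOrderIso.symm.le_iff_le.1 hy)
  have h1 : c ≤ d := hx'.elim le_of_lt fun h => h.1.le
  have h2 : d ≤ c := hy'.elim le_of_lt fun h => h.1.le
  obtain rfl := le_antisymm h1 h2
  exact ⟨z, rfl, (factorPos_le_iff e).1 hx, (factorPos_le_iff e).1 hy⟩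

theorem letter_factorPos (e : WordIso w (concat f)) (c : ι) (x : (f c).Pos) :
    w.letter (factorPos e c x) = (f c).letter x := by
  rw [← e.letter_eq, factorPos, OrderIso.apply_symm_apply]
  rfl

/-- There are finitely many factors, and each of them is restricted. -/
theorem Tame.finite_letter (hw : w.Tame) (a : X × Bool) : {p | w.letter p = a}.Finite := by
  obtain ⟨N, f, hf, ⟨e⟩⟩ := hw
  have : {p | w.letter p = a} ⊆ ⋃ i, factorPos e i '' {x | (f i).letter x = a} := by
    intro p hp
    obtain ⟨i, x, rfl⟩ := exists_factorPos e p
    rw [Set.mem_ofPred_eq, letter_factorPos] at hp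
    exact Set.mem_iUnion.2 ⟨i, x, hp, rfl⟩
  exact (Set.finite_iUnion fun i => ((hf i).1 a).image _).subset this

theorem Tame.finite_letter_fst (hw : w.Tame) (x : X) : {p | (w.letter p).1 = x}.Finite := by
  refine ((hw.finite_letter (x, true)).union (hw.finite_letter (x, false))).subset ?_
  intro p hp
  obtain rfl : (w.letter p).1 = x := hp
  cases h : (w.letter p).2
  · exact Or.inr (Prod.ext rfl h)
  · exact Or.inl (Prod.ext rfl h)

end Word

/-! ### Regularity of one side, and of the whole system -/

namespace BandSystem

variable {P : Type v} [LinearOrder P] {X : Type u}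

/-- The conditions of `System.Regular` for the bands on one side. -/
structure Regular (B : BandSystem P) (key : P → X) : Prop where
  finite_lineBand : Finite B.LineBand
  finite_archBand : Finite B.ArchBand
  exists_initial : ∀ p, ∃ s d, B.initialPoint s d = some p
  unique : ∀ s d t e p, B.initialPoint s d = some p → B.initialPoint t e = some p →
    s = t ∧ d = e
  convex : ∀ s t d p r q, B.band s = B.band t → B.initialPoint s d = some p →
    B.initialPoint t d = some q → p ≤ r → r ≤ q →
      ∃ c, B.initialPoint c d = some r ∧ B.band s = B.band c
  anti : ∀ b x y, B.source b x < B.source b y ↔ B.target b y < B.target b x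
  key_eq : ∀ b x, key (B.source b x) = key (B.target b x)

/-- A description of the segments to which the bands are glued: the points of the segment with
index `c` are the `pos c x`, and `start c x` is the line or arch that starts there. -/
structure Coding (B : BandSystem P) {ι : Type} (F : ι → Type v) (pos : ∀ c, F c → P)
    (start : ∀ c, F c → B.Strand × Bool) : Prop where
  injective : Function.Injective (fun y : Σ c, F c => pos y.1 y.2)
  surjective : ∀ p, ∃ c x, pos c x = p
  convex : ∀ c x y p, pos c x ≤ p → p ≤ pos c y → ∃ z, pos c z = p
  initialPoint_start : ∀ c x, B.initialPoint (start c x).1 (start c x).2 = some (pos c x)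
  exists_start : ∀ s d p, B.initialPoint s d = some p → ∃ c x, start c x = (s, d)
  coherent_iff : ∀ c x c' x', (B.band (start c x).1 = B.band (start c' x').1 ∧
    (start c x).2 = (start c' x').2) ↔ c = c'

/-- The segments partition the positions into convex pieces, and a segment amounts to a band
together with a direction of entry; uniqueness and convexity are read off from this. -/
theorem Coding.regular {B : BandSystem P} {ι : Type} {F : ι → Type v} {pos : ∀ c, F c → P}
    {start : ∀ c, F c → B.Strand × Bool} (h : B.Coding F pos start) {key : P → X}
    (hl : Finite B.LineBand) (ha : Finite B.ArchBand)
    (anti : ∀ b x y, B.source b x < B.source b y ↔ B.target b y < B.target b x)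
    (key_eq : ∀ b x, key (B.source b x) = key (B.target b x)) : B.Regular key where
  finite_lineBand := hl
  finite_archBand := ha
  exists_initial p := by
    obtain ⟨c, x, rfl⟩ := h.surjective p
    exact ⟨_, _, h.initialPoint_start c x⟩
  unique s d t e p hs ht := by
    obtain ⟨c, x, hx⟩ := h.exists_start s d p hs
    obtain ⟨c', x', hx'⟩ := h.exists_start t e p ht
    have h1 := h.initialPoint_start c x
    have h2 := h.initialPoint_start c' x'
    rw [hx] at h1
    rw [hx'] at h2
    have h3 : pos c x = pos c' x' := Option.some_inj.1 (h1.symm.trans (hs.trans (ht.symm.trans h2)))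
    have h4 : (⟨c, x⟩ : Σ c, F c) = ⟨c', x'⟩ := h.injective h3
    cases h4
    exact Prod.mk.inj (hx.symm.trans hx')
  convex s t d p r q hst hs ht hpr hrq := by
    obtain ⟨c, x, hx⟩ := h.exists_start s d p hs
    obtain ⟨c', y, hy⟩ := h.exists_start t d q ht
    obtain rfl := (h.coherent_iff c x c' y).1 (by rw [hx, hy]; exact ⟨hst, rfl⟩)
    have h1 := h.initialPoint_start c x
    have h2 := h.initialPoint_start c y
    rw [hx] at h1
    rw [hy] at h2
    obtain rfl : p = pos c x := Option.some_inj.1 (hs.symm.trans h1)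
    obtain rfl : q = pos c y := Option.some_inj.1 (ht.symm.trans h2)
    obtain ⟨z, rfl⟩ := h.convex c x y r hpr hrq
    have h3 := (h.coherent_iff c x c z).2 rfl
    have h4 := h.initialPoint_start c z
    rw [hx] at h3
    rw [← h3.2] at h4
    exact ⟨_, h4, h3.1⟩
  anti := anti
  key_eq := key_eq

theorem Regular.anti_initialPoint {B : BandSystem P} {key : P → X} (h : B.Regular key)
    {s t : B.Strand} {d : Bool} {p q p' q' : P} (hst : B.band s = B.band t)
    (hp : B.initialPoint s d = some p) (hq : B.initialPoint t d = some q)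
    (hp' : B.terminalPoint s d = some p') (hq' : B.terminalPoint t d = some q') (hpq : p < q) :
    q' < p' := by
  rcases s with ⟨b, x⟩ | ⟨b, x⟩ <;> rcases t with ⟨c, y⟩ | ⟨c, y⟩
  · cases d <;> simp [initialPoint, terminalPoint] at hp hp'
  · simp [band] at hst
  · simp [band] at hst
  · obtain rfl : b = c := by simpa [band] using hst
    cases d
    · simp only [initialPoint, terminalPoint, Option.some_inj, Bool.not_false] at hp hq hp' hq'
      subst hp hq hp' hq'
      exact (h.anti b y x).2 hpq
    · simp only [initialPoint, terminalPoint, Option.some_inj, Bool.not_true] at hp hq hp' hq'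
      subst hp hq hp' hq'
      exact (h.anti b x y).1 hpq

theorem Regular.key_eq_initialPoint {B : BandSystem P} {key : P → X} (h : B.Regular key)
    {s : B.Strand} {d : Bool} {p q : P} (hp : B.initialPoint s d = some p)
    (hq : B.terminalPoint s d = some q) : key p = key q := by
  rcases s with ⟨b, x⟩ | ⟨b, x⟩
  · cases d <;> simp [initialPoint, terminalPoint] at hp hq
  · cases d
    · simp only [initialPoint, terminalPoint, Option.some_inj, Bool.not_false] at hp hq
      subst hp hq
      exact (h.key_eq b x).symm
    · simp only [initialPoint, terminalPoint, Option.some_inj, Bool.not_true] at hp hq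
      subst hp hq
      exact h.key_eq b x

end BandSystem

theorem System.regular {P : Type v} [LinearOrder P] {X : Type u} {A : System P} {key : P → X}
    (hu : A.upper.Regular key) (hl : A.lower.Regular key)
    (hkey : ∀ x, {p | key p = x}.Finite) : A.Regular key where
  finite_band := by
    have := hu.finite_lineBand
    have := hu.finite_archBand
    have := hl.finite_lineBand
    have := hl.finite_archBand
    infer_instance
  exists_initial p c := by
    cases c
    · obtain ⟨s, d, h⟩ := hl.exists_initial p
      exact ⟨(.inr s, d), rfl, h⟩
    · obtain ⟨s, d, h⟩ := hu.exists_initial p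
      exact ⟨(.inl s, d), rfl, h⟩
  unique := by
    rintro ⟨s | s, d⟩ ⟨t | t, e⟩ p h hs ht
    · obtain ⟨rfl, rfl⟩ := hu.unique s d t e p hs ht
      rfl
    · simp at h
    · simp at h
    · obtain ⟨rfl, rfl⟩ := hl.unique s d t e p hs ht
      rfl
  convex := by
    rintro ⟨s | s, d⟩ ⟨t | t, e⟩ p r q ⟨h, h'⟩ hs ht hpr hrq <;> obtain rfl : d = e := h'
    · obtain ⟨c, hc, hsc⟩ := hu.convex s t d p r q (Sum.inl_injective h) hs ht hpr hrq
      exact ⟨(.inl c, d), hc, congrArg Sum.inl hsc, rfl⟩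
    · simp [System.band] at h
    · simp [System.band] at h
    · obtain ⟨c, hc, hsc⟩ := hl.convex s t d p r q (Sum.inr_injective h) hs ht hpr hrq
      exact ⟨(.inr c, d), hc, congrArg Sum.inr hsc, rfl⟩
  anti := by
    rintro ⟨s | s, d⟩ ⟨t | t, e⟩ p q p' q' ⟨h, h'⟩ hp hq hp' hq' hpq <;> obtain rfl : d = e := h'
    · exact hu.anti_initialPoint (Sum.inl_injective h) hp hq hp' hq' hpq
    · simp [System.band] at h
    · simp [System.band] at h
    · exact hl.anti_initialPoint (Sum.inr_injective h) hp hq hp' hq' hpq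
  key_eq := by
    rintro ⟨s | s, d⟩ p q hp hq
    · exact hu.key_eq_initialPoint hp hq
    · exact hl.key_eq_initialPoint hp hq
  finite_key := hkey

/-! ### The lower bands are regular -/

section Lower

variable {X : Type u} {w : Word.{u, v} X} (L : LowerConcatenation w)

namespace LowerConcatenation

/-- The line or arch that starts at a position of a factor. -/
noncomputable def start : ∀ c : LowerIndex L.m L.n, (Word.factors L.iso c).Pos → L.bands.Strand × Bool
  | .w₁, x => (.line (.inl ()) x, true)
  | .thetaInv j, x => (.arch (.inl j) ((L.θ j).ofInvPos x), true)
  | .eta j, x => (.line (.inr j) x, true)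
  | .theta j, x => (.arch (.inl j) x, false)
  | .sigmaInv i, x => (.arch (.inr (.inl i)) ((L.σ i).ofInvPos x), true)
  | .tauInv i, x => (.arch (.inr (.inr i)) ((L.τ i).ofInvPos x), true)
  | .sigma i, x => (.arch (.inr (.inl i)) x, false)
  | .tau i, x => (.arch (.inr (.inr i)) x, false)

/-- The band, and the direction, of the lines and arches that start at a factor. -/
def startBand : LowerIndex L.m L.n →
    ((Unit ⊕ Fin L.m) ⊕ (Fin L.m ⊕ (Fin L.n ⊕ Fin L.n))) × Bool
  | .w₁ => (.inl (.inl ()), true)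
  | .thetaInv j => (.inr (.inl j), true)
  | .eta j => (.inl (.inr j), true)
  | .theta j => (.inr (.inl j), false)
  | .sigmaInv i => (.inr (.inr (.inl i)), true)
  | .tauInv i => (.inr (.inr (.inr i)), true)
  | .sigma i => (.inr (.inr (.inl i)), false)
  | .tau i => (.inr (.inr (.inr i)), false)

theorem startBand_injective : Function.Injective L.startBand := by
  intro c c' h
  cases c <;> cases c' <;> simp_all [startBand]

theorem coding : L.bands.Coding (fun c => (Word.factors L.iso c).Pos) (Word.factorPos L.iso)
    L.start where
  injective := Word.factorPos_injective L.iso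
  surjective := Word.exists_factorPos L.iso
  convex c x y p hx hy := by
    obtain ⟨z, hz, -⟩ := Word.exists_factorPos_between L.iso hx hy
    exact ⟨z, hz⟩
  initialPoint_start c x := by
    cases c <;> rfl
  exists_start s d p h := by
    rcases s with ⟨_ | j, x⟩ | ⟨j | i | i, x⟩ <;> cases d
    · cases h
    · exact ⟨.w₁, x, rfl⟩
    · cases h
    · exact ⟨.eta j, x, rfl⟩
    · exact ⟨.theta j, x, rfl⟩
    · exact ⟨.thetaInv j, (L.θ j).invPos x, rfl⟩
    · exact ⟨.sigma i, x, rfl⟩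
    · exact ⟨.sigmaInv i, (L.σ i).invPos x, rfl⟩
    · exact ⟨.tau i, x, rfl⟩
    · exact ⟨.tauInv i, (L.τ i).invPos x, rfl⟩
  coherent_iff c x c' x' := by
    have h : ∀ c x, (L.bands.band (L.start c x).1, (L.start c x).2) = L.startBand c := by
      intro c x
      cases c <;> rfl
    rw [← L.startBand_injective.eq_iff]
    exact ⟨fun e => (h c x).symm.trans ((congrArg₂ Prod.mk e.1 e.2).trans (h c' x')),
      fun e => Prod.mk.inj ((h c x).trans (e.trans (h c' x').symm))⟩

theorem regular : L.bands.Regular (fun p => (w.letter p).1) := by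
  refine L.coding.regular ?_ ?_ ?_ ?_
  · exact inferInstanceAs (Finite (Unit ⊕ Fin L.m))
  · exact inferInstanceAs (Finite (Fin L.m ⊕ (Fin L.n ⊕ Fin L.n)))
  -- The source factor is an inverse word, whose order is the dual one, so both inequalities say
  -- that `y` precedes `x` in the factor itself.
  · rintro (j | i | i) x y
    · exact (Word.factorPos_lt_iff L.iso (c := .thetaInv j)).trans
        (Word.factorPos_lt_iff L.iso (c := .theta j)).symm
    · exact (Word.factorPos_lt_iff L.iso (c := .sigmaInv i)).trans
        (Word.factorPos_lt_iff L.iso (c := .sigma i)).symm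
    · exact (Word.factorPos_lt_iff L.iso (c := .tauInv i)).trans
        (Word.factorPos_lt_iff L.iso (c := .tau i)).symm
  · rintro (j | i | i) x
    · have h1 := congrArg Prod.fst (Word.letter_factorPos L.iso (.thetaInv j) ((L.θ j).invPos x))
      have h2 := congrArg Prod.fst (Word.letter_factorPos L.iso (.theta j) x)
      exact h1.trans h2.symm
    · have h1 := congrArg Prod.fst (Word.letter_factorPos L.iso (.sigmaInv i) ((L.σ i).invPos x))
      have h2 := congrArg Prod.fst (Word.letter_factorPos L.iso (.sigma i) x)
      exact h1.trans h2.symm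
    · have h1 := congrArg Prod.fst (Word.letter_factorPos L.iso (.tauInv i) ((L.τ i).invPos x))
      have h2 := congrArg Prod.fst (Word.letter_factorPos L.iso (.tau i) x)
      exact h1.trans h2.symm

end LowerConcatenation

end Lower

/-! ### The upper bands are regular -/

section Upper

variable {X : Type u} {w : Word.{u, v} X} (T : UpperConcatenation w)

namespace UpperConcatenation

/-- The names of the segments to which the upper bands are glued: the `tᵢ`, and the first and the
second factor removed in each step of the cancellation patterns. -/
abbrev Segment : Type := Fin (T.k + 1) ⊕ (Σ i : Fin T.k, Fin (T.pattern i).r) × Bool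

/-- The factor of the cancellation pattern that is removed in a given step: the first one (`true`)
or the second one (`false`). -/
def removed (b : Σ i : Fin T.k, Fin (T.pattern i).r) : Bool → Fin (2 * (T.pattern b.1).r)
  | true => (T.pattern b.1).fst b.2
  | false => (T.pattern b.1).snd b.2

theorem removed_injective {i : Fin T.k} {s s' : Fin (T.pattern i).r} {d d' : Bool}
    (h : T.removed ⟨i, s⟩ d = T.removed ⟨i, s'⟩ d') : s = s' ∧ d = d' := by
  have hinj := (T.pattern i).bijective.1
  cases d <;> cases d'
  · exact ⟨Sum.inr_injective (hinj (a₁ := .inr s) (a₂ := .inr s') h), rfl⟩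
  · cases hinj (a₁ := .inr s) (a₂ := .inl s') h
  · cases hinj (a₁ := .inl s) (a₂ := .inr s') h
  · exact ⟨Sum.inl_injective (hinj (a₁ := .inl s) (a₂ := .inl s') h), rfl⟩

theorem exists_removed (i : Fin T.k) (c : Fin (2 * (T.pattern i).r)) :
    ∃ s d, T.removed ⟨i, s⟩ d = c := by
  obtain ⟨s | s, rfl⟩ := (T.pattern i).bijective.2 c
  · exact ⟨s, true, rfl⟩
  · exact ⟨s, false, rfl⟩

/-- The word at a segment. -/
def segmentWord : T.Segment → Word.{u, v} X
  | .inl i => T.t i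
  | .inr (b, d) => (T.pattern b.1).z (T.removed b d)

/-- The points of a segment. -/
noncomputable def segmentPos : ∀ c : T.Segment, (T.segmentWord c).Pos → w.Pos
  | .inl i, x => Word.factorPos T.iso (.t i) x
  | .inr (b, d), x => T.zPos b.1 (T.removed b d) x

/-- The line or arch that starts at a point of a segment. -/
noncomputable def start : ∀ c : T.Segment, (T.segmentWord c).Pos → T.bands.Strand × Bool
  | .inl i, x => (.line i x, true)
  | .inr (b, true), x =>
      (.arch b (((T.pattern b.1).inverse b.2).toOrderIso.symm (Word.invPos _ x)), true)
  | .inr (b, false), x => (.arch b x, false)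

/-- The band, and the direction, of the lines and arches that start at a segment. -/
def startBand : T.Segment →
    (Fin (T.k + 1) ⊕ (Σ i : Fin T.k, Fin (T.pattern i).r)) × Bool
  | .inl i => (.inl i, true)
  | .inr (b, d) => (.inr b, d)

theorem startBand_injective : Function.Injective T.startBand := by
  rintro (i | ⟨b, d⟩) (i' | ⟨b', d'⟩) h <;> simp_all [startBand]

theorem zPos_lt_iff {i : Fin T.k} {c : Fin (2 * (T.pattern i).r)}
    {x y : ((T.pattern i).z c).Pos} : T.zPos i c x < T.zPos i c y ↔ x < y :=
  (Word.factorPos_lt_iff T.iso (c := .u i)).trans (Word.factorPos_lt_iff (T.pattern i).iso)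

theorem letter_zPos (i : Fin T.k) (c : Fin (2 * (T.pattern i).r))
    (x : ((T.pattern i).z c).Pos) : w.letter (T.zPos i c x) = ((T.pattern i).z c).letter x :=
  (Word.letter_factorPos T.iso (.u i) _).trans (Word.letter_factorPos (T.pattern i).iso c x)

theorem segmentPos_injective :
    Function.Injective (fun y : Σ c, (T.segmentWord c).Pos => T.segmentPos y.1 y.2) := by
  have hinj := Word.factorPos_injective T.iso
  rintro ⟨i | ⟨⟨i, s⟩, d⟩, x⟩ ⟨i' | ⟨⟨i', s'⟩, d'⟩, x'⟩ h
  · cases hinj (a₁ := ⟨.t i, x⟩) (a₂ := ⟨.t i', x'⟩) h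
    rfl
  · cases hinj (a₁ := ⟨.t i, x⟩) (a₂ := ⟨.u i', _⟩) h
  · cases hinj (a₁ := ⟨.u i, _⟩) (a₂ := ⟨.t i', x'⟩) h
  -- Two levels are decoded: first the factor `u i` of the word, then the factor `z c` of its
  -- subdivision, which determines the step and its side by bijectivity of the pattern.
  · have h1 := hinj (a₁ := ⟨.u i, _⟩) (a₂ := ⟨.u i', _⟩) h
    rw [Sigma.mk.injEq] at h1
    obtain ⟨h1, h2⟩ := h1
    obtain rfl : i = i' := UpperIndex.u.inj h1
    have h3 := Word.factorPos_injective (T.pattern i).iso (a₁ := ⟨T.removed ⟨i, s⟩ d, x⟩)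
      (a₂ := ⟨T.removed ⟨i, s'⟩ d', x'⟩) (eq_of_heq h2)
    obtain ⟨h3, h4⟩ := Sigma.mk.inj h3
    obtain ⟨rfl, rfl⟩ := T.removed_injective h3
    rw [eq_of_heq h4]

theorem coding : T.bands.Coding (fun c => (T.segmentWord c).Pos) T.segmentPos T.start where
  injective := T.segmentPos_injective
  surjective p := by
    obtain ⟨i | i, x, rfl⟩ := Word.exists_factorPos T.iso p
    · exact ⟨.inl i, x, rfl⟩
    · obtain ⟨c, y, rfl⟩ := Word.exists_factorPos (T.pattern i).iso x
      obtain ⟨s, d, rfl⟩ := T.exists_removed i c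
      exact ⟨.inr (⟨i, s⟩, d), y, rfl⟩
  convex c x y p hx hy := by
    rcases c with i | ⟨b, d⟩
    · obtain ⟨z, hz, -⟩ := Word.exists_factorPos_between T.iso (c := .t i) hx hy
      exact ⟨z, hz⟩
    · obtain ⟨z, rfl, hxz, hzy⟩ :=
        Word.exists_factorPos_between T.iso (c := .u b.1) hx hy
      obtain ⟨z, rfl, -⟩ := Word.exists_factorPos_between (T.pattern b.1).iso hxz hzy
      exact ⟨z, rfl⟩
  initialPoint_start c x := by
    rcases c with i | ⟨b, _ | _⟩
    · rfl
    · rfl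
    -- Arches are indexed by the second removed factor, so at the first one the isomorphism of the
    -- pattern meets its own inverse.
    · change some (T.zPos b.1 _ (Word.ofInvPos _ (((T.pattern b.1).inverse b.2).toOrderIso
        (((T.pattern b.1).inverse b.2).toOrderIso.symm (Word.invPos _ x))))) = _
      rw [OrderIso.apply_symm_apply]
      rfl
  exists_start s d p h := by
    rcases s with ⟨i, x⟩ | ⟨b, x⟩ <;> cases d
    · cases h
    · exact ⟨.inl i, x, rfl⟩
    · exact ⟨.inr (b, false), x, rfl⟩
    · refine ⟨.inr (b, true), Word.ofInvPos _ (((T.pattern b.1).inverse b.2).toOrderIso x), ?_⟩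
      exact congrArg (fun y => ((.arch b y : T.bands.Strand), true))
        (((T.pattern b.1).inverse b.2).toOrderIso.symm_apply_apply x)
  coherent_iff c x c' x' := by
    have h : ∀ c x, (T.bands.band (T.start c x).1, (T.start c x).2) = T.startBand c := by
      rintro (i | ⟨b, _ | _⟩) x <;> rfl
    rw [← T.startBand_injective.eq_iff]
    exact ⟨fun e => (h c x).symm.trans ((congrArg₂ Prod.mk e.1 e.2).trans (h c' x')),
      fun e => Prod.mk.inj ((h c x).trans (e.trans (h c' x').symm))⟩

theorem regular : T.bands.Regular (fun p => (w.letter p).1) := by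
  refine T.coding.regular ?_ ?_ ?_ ?_
  · exact inferInstanceAs (Finite (Fin (T.k + 1)))
  · exact inferInstanceAs (Finite (Σ i : Fin T.k, Fin (T.pattern i).r))
  · intro b x y
    refine T.zPos_lt_iff.trans (Iff.trans ?_ T.zPos_lt_iff.symm)
    exact ((T.pattern b.1).inverse b.2).toOrderIso.lt_iff_lt (x := y) (y := x)
  · intro b x
    have h1 := T.letter_zPos b.1 ((T.pattern b.1).fst b.2)
      (Word.ofInvPos _ (((T.pattern b.1).inverse b.2).toOrderIso x))
    have h2 := T.letter_zPos b.1 ((T.pattern b.1).snd b.2) x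
    have h3 := ((T.pattern b.1).inverse b.2).letter_eq x
    exact (congrArg Prod.fst h1).trans
      ((congrArg Prod.fst h3).trans (congrArg Prod.fst h2.symm))

end UpperConcatenation

end Upper

/-- The key is the letter without its exponent, the part that mutually inverse letters share.
Tameness makes its fibres finite. -/
theorem system_regular {X : Type u} {w : Word.{u, v} X} (hw : w.Tame) (T : UpperConcatenation w)
    (L : LowerConcatenation w) : (system T L).Regular (fun p => (w.letter p).1) :=
  System.regular T.regular L.regular hw.finite_letter_fst

end ArchLineBand

theorem proposition6p6 {X : Type u} (w : ArchLineBand.Word.{u, v} X) (hw : w.Tame)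
    (T : ArchLineBand.UpperConcatenation w) (L : ArchLineBand.LowerConcatenation w) :
    (Equivalence (ArchLineBand.system T L).Parallel ∧
      Finite (Quot (ArchLineBand.system T L).Parallel)) ∧
    (Equivalence (ArchLineBand.system T L).CoherentlyParallel ∧
      Finite (Quot (ArchLineBand.system T L).CoherentlyParallel)) := by
  have h := ArchLineBand.system_regular hw T L
  exact ⟨⟨h.equivalence_parallel, h.finite_quot_parallel⟩,
    h.equivalence_coherentlyParallel, h.finite_quot_coherentlyParallel⟩
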